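/- \textbf{Definitions.} Let $q\ge 2$, $c\ge 1$, $d\ge 1$ be integers; $\ln$ is the natural logarithm and $0\ln 0=0$. For $x\in[0,1]$ and $y\in(0,1)$ put \[ H_q(x)=x\ln\frac1x+(1-x)\ln\frac1{1-x}+x\ln(q-1),\qquad D(x\|y)=x\ln\frac xy+(1-x)\ln\frac{1-x}{1-y}, \] \[ \rho_{q,d}(y)=\ln\Bigl[1+(q-1)\Bigl(1-\frac{qy}{q-1}\Bigr)^d\Bigr],\qquad \delta_{q,d}(x)=\inf_{y\in(0,1)}\bigl[d\,D(x\|y)+\rho_{q,d}(y)\bigr]\in[-\infty,\infty), \] \[ \omega_{q,c,d}(x)=H_q(x)+\frac cd\bigl[\delta_{q,d}(x)-\ln q\bigr]. \] Let $x_1=1-\frac1d$ if $q=2$ and $d$ is odd, and $x_1=1$ otherwise. \textbf{Theorem.} Let $q\ge 2$, $c\ge 1$ and $d\ge\max\{c,3\}$ be integers. The function $\omega=\omega_{q,c,d}$ is finite and continuous on $[0,x_1]$ and twice differentiable on $(0,x_1)$. Moreover: (1) If $c=1$, then $\omega$ is concave on $(0,x_1)$, strictly increasing on $(0,1-1/q)$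 and strictly decreasing on $(1-1/q,x_1)$. (2) If $c=2$, then $\omega$ is strictly increasing on $(0,1-1/q)$ and strictly decreasing on $(1-1/q,x_1)$. If in addition $q=2$, then $\omega$ is concave on $(0,x_1)$; if $q\ne2$, there is $x_2\in(0,1-1/q)$ such that $\omega$ is convex on $(0,x_2)$ and concave on $(x_2,1)$. (3) If $c\ge3$, $q=2$ and $d$ is even, then $\omega(1-x)=\omega(x)$ for all $x\in[0,1]$. There are $x_2\in(0,\frac12)$ and $x_3\in(0,x_2)$ such that $\omega$ is convex on $(0,x_2)$, concave on $(x_2,\frac12)$, strictly decreasing on $(0,x_3)$ and strictly increasing on $(x_3,\frac12)$; and $\omega$ has a unique zero $x_0$ in $(0,\frac12]$, which satisfies $x_0\in(x_3,\frac12]$, $\omega<0$ on $(0,x_0)$ and $\omega>0$ on $(x_0,\frac12)$. (4) If $c\ge3$, and $q\ne2$ or $d$ is odd, then there are $x_2\in(0,1-1/q)$ and $x_3\in(0,x_2)$ such that $\omega$ is convex on $(0,x_2)$, concave on $(x_2,x_1)$, strictly decreasing on $(0,x_3)$ and on $(1-1/q,x_1)$, and strictly increasing on $(x_3,1-1/q)$;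 and $\omega$ has a unique zero $x_0$ in $(0,1-1/q]$, which satisfies $x_0\in(x_3,1-1/q]$, $\omega<0$ on $(0,x_0)$ and $\omega>0$ on $(x_0,1-1/q)$. -/

import Mathlib

/-- The information divergence `D(x‖y) = x ln (x / y) + (1 - x) ln ((1 - x) / (1 - y))`, with the
convention `0 ln 0 = 0`. It is used for `x ∈ [0, 1]` and `y ∈ (0, 1)`. -/
noncomputable def infoDivergence (x y : ℝ) : ℝ :=
  x * Real.log (x / y) + (1 - x) * Real.log ((1 - x) / (1 - y))

/-- `ρ_{q,d}(x) = ln [1 + (q - 1) (1 - q x / (q - 1)) ^ d]`. -/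
noncomputable def rhoLDPC (q d : ℕ) (x : ℝ) : ℝ :=
  Real.log (1 + ((q : ℝ) - 1) * (1 - (q : ℝ) * x / ((q : ℝ) - 1)) ^ d)

/-- The two-variable function `δ_{q,d}(x, y) = d D(x‖y) + ρ_{q,d}(y)`. -/
noncomputable def deltaTwo (q d : ℕ) (x y : ℝ) : ℝ :=
  (d : ℝ) * infoDivergence x y + rhoLDPC q d y

/-- `δ_{q,d}(x) = inf_{y ∈ (0, 1)} δ_{q,d}(x, y)`. The infimum is taken in the extended reals, since
it equals `-∞` for some `x` when `q = 2` and `d` is odd. -/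
noncomputable def deltaLDPC (q d : ℕ) (x : ℝ) : EReal :=
  ⨅ y ∈ Set.Ioo (0 : ℝ) 1, (deltaTwo q d x y : EReal)

/-- The growth rate `ω_{q,c,d}(x) = H_q(x) + (c / d) [δ_{q,d}(x) - ln q]`, an extended real number;
`Real.qaryEntropy q` is the entropy function `H_q`. -/
noncomputable def omegaLDPC (q c d : ℕ) (x : ℝ) : EReal :=
  (Real.qaryEntropy q x : EReal) +
    (((c : ℝ) / (d : ℝ) : ℝ) : EReal) * (deltaLDPC q d x - (Real.log (q : ℝ) : EReal))

/-- The real-valued version of the growth rate `ω_{q,c,d}`, meaningful where the latter is finite. -/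
noncomputable def omegaReal (q c d : ℕ) (x : ℝ) : ℝ := (omegaLDPC q c d x).toReal

open scoped Classical in
/-- The right endpoint `x₁`: it is `1 - 1 / d` if `q = 2` and `d` is odd, and `1` otherwise. -/
noncomputable def xOne (q d : ℕ) : ℝ :=
  if q = 2 ∧ Odd d then 1 - 1 / (d : ℝ) else 1

open Set Filter Topology

/-! Put `Q = q - 1`, `d = n + 2`, `e = c - 1` and `t = 1 - q y / (q - 1)`, so that `y ∈ (0, 1)`
becomes `t ∈ (-1/Q, 1)`. Up to terms free of `t`, `deltaTwo` is then `potential`, which is affine in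
`x` and whose `t`-derivative has the sign of `x - critPoint Q n t`. Since `critPoint` decreases from
`x₁` to `0` (limits at the ends), each `x ∈ (0, x₁)` has a unique minimiser `t = critParam Q n x`.
By the envelope principle the minimum has `x`-derivative `(n + 2) L(t)`, while `H_q'(x) = L(t) + L(t
^ (n + 1))` (`log_odds_critPoint`). Hence `ω'(x) = L(t) - e L(t ^ (n + 1))`, which is `growthSlope`
(`hasDerivAt_growthRate`).

As `t` decreases in `x`, the shape of `ω` is read off from the sign and the monotonicity of
`growthSlope`, the latter governed by the polynomial `slopeSign`. For `t > 0`, division by `(1 - t)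
t ^ n` leaves a convex function, so there is a single sign change when `c ≥ 3`, or `c = 2` and `q ≠
2` (`exists_slopeSign_change`); it gives the inflection point `x₂`. For `t < 0` the polynomial is
positive unless `q = 2` and `d` is even (`slopeSign_pos_of_lt`). With `e = -1` the same polynomial
shows that `critPoint` is decreasing.

Continuity at `0` and `x₁` comes from the infimum being one of affine functions of `x`. The zero for
`c ≥ 3` exists because `ω(0) = 0`, `ω` first decreases, and `ω(1 - 1/q) = (1 - c/d) ln q ≥ 0`. -/

/-- The sign of the derivative of `t ↦ L(t) - e L(t ^ (n + 1))`, where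
`L(t) = ln ((1 + Q t) / (1 - t))`. -/
def slopeSign (Q : ℝ) (n : ℕ) (e t : ℝ) : ℝ :=
  (1 + Q * t ^ (n + 1)) * (1 - t ^ (n + 1)) - e * (n + 1) * t ^ n * ((1 + Q * t) * (1 - t))

/-! ### Sign analysis of the polynomial `slopeSign`. -/

section Elementary

variable {Q t e r : ℝ} {n : ℕ}

lemma one_add_mul_pos_of_mem (hQ : 1 ≤ Q) (ht : t ∈ Ioo (-Q⁻¹) 1) : 0 < 1 + Q * t := by
  have h := mul_lt_mul_of_pos_left ht.1 (by linarith : 0 < Q)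
  rw [mul_neg, mul_inv_cancel₀ (by linarith)] at h
  linarith

lemma mem_Ioo_of_one_add_mul_pos (hQ : 1 ≤ Q) (h : 0 < 1 + Q * t) (h1 : t < 1) :
    t ∈ Ioo (-Q⁻¹) 1 := by
  refine ⟨?_, h1⟩
  have : -Q⁻¹ = -1 / Q := by rw [neg_div, one_div]
  rw [this, div_lt_iff₀ (by linarith)]
  linarith

lemma abs_lt_one_of_mem (hQ : 1 ≤ Q) (ht : t ∈ Ioo (-Q⁻¹) 1) : |t| < 1 := by
  have : Q⁻¹ ≤ 1 := inv_le_one_of_one_le₀ hQ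
  exact abs_lt.2 ⟨by linarith [ht.1], ht.2⟩

lemma zero_mem_Ioo_neg_inv (hQ : 1 ≤ Q) : (0 : ℝ) ∈ Ioo (-Q⁻¹) 1 :=
  ⟨by have : 0 < Q := by linarith
      simpa using this, one_pos⟩

lemma mem_of_mem_Ico_zero_one (hQ : 1 ≤ Q) (ht : t ∈ Ico (0 : ℝ) 1) : t ∈ Ioo (-Q⁻¹) 1 :=
  ⟨(zero_mem_Ioo_neg_inv hQ).1.trans_le ht.1, ht.2⟩

lemma pow_succ_lt_one (ht : |t| < 1) (k : ℕ) : t ^ (k + 1) < 1 := by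
  refine (le_abs_self _).trans_lt ?_
  rw [abs_pow]
  exact pow_lt_one₀ (abs_nonneg _) ht (by omega)

lemma neg_le_pow_succ (hr : |t| ≤ 1) (k : ℕ) : -|t| ≤ t ^ (k + 1) := by
  refine le_trans ?_ (neg_abs_le _)
  rw [abs_pow]
  exact neg_le_neg (pow_le_of_le_one (abs_nonneg _) hr (by omega))

lemma pow_succ_mem (hQ : 1 ≤ Q) (ht : t ∈ Ioo (-Q⁻¹) 1) (k : ℕ) :
    t ^ (k + 1) ∈ Ioo (-Q⁻¹) 1 := by
  have habs := abs_lt_one_of_mem hQ ht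
  refine ⟨?_, pow_succ_lt_one habs k⟩
  rcases le_or_gt 0 t with h | h
  · exact (zero_mem_Ioo_neg_inv hQ).1.trans_le (by positivity)
  · have := neg_le_pow_succ habs.le k
    rw [abs_of_neg h] at this
    linarith [ht.1]

/-- This is AM-GM: after division by `1 - r ^ 2` the right side is the sum of `r ^ (2 j)` for `j ≤
n`, whose `n + 1` terms have geometric mean `r ^ n`. In the induction, the new difference is `r`
times the old one plus a positive product. -/
lemma mul_pow_lt_one_sub_pow (hr : 0 ≤ r) (hr1 : r < 1) (hn : 1 ≤ n) :
    (n + 1) * r ^ n * (1 - r ^ 2) < 1 - r ^ (2 * n + 2) := by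
  induction n, hn using Nat.le_induction with
  | base =>
    have h2 : 0 < 1 - r ^ 2 := by nlinarith
    norm_num
    nlinarith [mul_pos h2 (pow_pos (sub_pos.2 hr1) 2)]
  | succ n hn ih =>
    have h1 : r ^ (n + 1) ≤ 1 := pow_le_one₀ hr hr1.le
    have h2 : r ^ (n + 2) < 1 := pow_lt_one₀ hr hr1 (by omega)
    have h3 : 0 < 1 - r ^ (n + 1) := sub_pos.2 (pow_lt_one₀ hr hr1 (by omega))
    have h4 : 0 < (1 - r) * ((1 - r ^ (n + 1)) * (1 - r ^ (n + 2))) :=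
      mul_pos (by linarith) (mul_pos h3 (by linarith))
    have h5 := mul_le_mul_of_nonneg_left ih.le hr
    have h6 : (1 - r ^ (2 * (n + 1) + 2)) - (n + 1 + 1) * r ^ (n + 1) * (1 - r ^ 2) =
        (r * (1 - r ^ (2 * n + 2)) - r * ((n + 1) * r ^ n * (1 - r ^ 2))) +
          (1 - r) * ((1 - r ^ (n + 1)) * (1 - r ^ (n + 2))) := by ring
    push_cast
    linarith

lemma one_add_pow_mul_pos (hQ : 1 ≤ Q) (ht : t ∈ Ioo (-Q⁻¹) 1) (k : ℕ) :
    0 < 1 + Q * t ^ (k + 1) :=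
  one_add_mul_pos_of_mem hQ (pow_succ_mem hQ ht k)

lemma slopeSign_leading_pos (hQ : 1 ≤ Q) (ht : t ∈ Ioo (-Q⁻¹) 1) :
    0 < (1 + Q * t ^ (n + 1)) * (1 - t ^ (n + 1)) :=
  mul_pos (one_add_pow_mul_pos hQ ht n) (sub_pos.2 (pow_succ_mem hQ ht n).2)

lemma slopeSign_pos_of_nonpos (hQ : 1 ≤ Q) (ht : t ∈ Ioo (-Q⁻¹) 1) (h : e * t ^ n ≤ 0) :
    0 < slopeSign Q n e t := by
  have h1 := slopeSign_leading_pos (n := n) hQ ht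
  have h2 : 0 < (n + 1) * ((1 + Q * t) * (1 - t)) :=
    mul_pos (by positivity) (mul_pos (one_add_mul_pos_of_mem hQ ht) (sub_pos.2 ht.2))
  have h3 := mul_nonneg (neg_nonneg.2 h) h2.le
  unfold slopeSign
  nlinarith

/-- Only odd `n` and `t < 0` need work. There `Q = 1` is the worst case, which is the AM-GM bound
above. This sign is what makes `critPoint` decreasing. -/
lemma slopeSign_neg_one_pos (hQ : 1 ≤ Q) (hn : 1 ≤ n) (ht : t ∈ Ioo (-Q⁻¹) 1) :
    0 < slopeSign Q n (-1) t := by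
  rcases le_or_gt 0 (t ^ n) with h | h
  · exact slopeSign_pos_of_nonpos hQ ht (by linarith)
  · have hodd : Odd n := by
      by_contra hne
      exact absurd h (not_lt.2 ((Nat.not_odd_iff_even.1 hne).pow_nonneg t))
    have ht0 : t < 0 := by
      by_contra hne
      exact absurd h (not_lt.2 (pow_nonneg (not_lt.1 hne) n))
    obtain ⟨r, rfl⟩ : ∃ r, t = -r := ⟨-t, by ring⟩
    have hr0 : 0 < r := by linarith
    have hr1 : r < 1 := by simpa [abs_of_pos hr0] using abs_lt_one_of_mem hQ ht
    have hQr := one_add_mul_pos_of_mem hQ ht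
    have key := mul_pow_lt_one_sub_pow hr0.le hr1 hn
    have e1 : (-r) ^ n = -r ^ n := hodd.neg_pow r
    have e2 : (-r) ^ (n + 1) = r ^ (n + 1) := hodd.add_one.neg_pow r
    have h1 : r ^ (n + 1) < 1 := pow_lt_one₀ hr0.le hr1 (by omega)
    have h2 : 0 < r ^ (n + 1) := by positivity
    have h3 : (1 + r ^ (n + 1)) * (1 - r ^ (n + 1)) ≤
        (1 + Q * r ^ (n + 1)) * (1 - r ^ (n + 1)) := by
      apply mul_le_mul_of_nonneg_right _ (by linarith)
      nlinarith
    have h4 : (n + 1) * r ^ n * ((1 - Q * r) * (1 + r)) ≤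
        (n + 1) * r ^ n * ((1 - r) * (1 + r)) := by
      apply mul_le_mul_of_nonneg_left _ (by positivity)
      apply mul_le_mul_of_nonneg_right _ (by linarith)
      nlinarith
    have h5 : (1 + r ^ (n + 1)) * (1 - r ^ (n + 1)) = 1 - r ^ (2 * n + 2) := by ring
    unfold slopeSign
    rw [e1, e2]
    nlinarith

lemma slopeSign_binary_nonneg (hn : 1 ≤ n) (ht : |t| < 1) : 0 ≤ slopeSign 1 n 1 t := by
  have key := mul_pow_lt_one_sub_pow (abs_nonneg t) ht hn
  have h1 : |t| ^ (2 * n + 2) = t ^ (2 * n + 2) := by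
    rw [show 2 * n + 2 = 2 * (n + 1) by ring, pow_mul, pow_mul, sq_abs]
  have h2 : t ^ n ≤ |t| ^ n := by rw [← abs_pow]; exact le_abs_self _
  have h3 : 0 < 1 - t ^ 2 := by rw [← sq_abs]; nlinarith [abs_nonneg t]
  rw [h1, sq_abs] at key
  have h4 : (n + 1) * t ^ n * (1 - t ^ 2) ≤ (n + 1) * |t| ^ n * (1 - t ^ 2) := by gcongr
  unfold slopeSign
  have : (1 + 1 * t ^ (n + 1)) * (1 - t ^ (n + 1)) - 1 * (n + 1) * t ^ n * ((1 + 1 * t) * (1 - t))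
      = 1 - t ^ (2 * n + 2) - (n + 1) * t ^ n * (1 - t ^ 2) := by ring
  linarith

/-- The left side does not increase with `n`, since `((n + 4) / (n + 3)) ^ 2 ≤ 16 / 9 < 2`; its
value at `n = 0` is `9`. -/
lemma sq_mul_pow_le_nine (hr : 0 ≤ r) (hr1 : r ≤ 1 / 2) (n : ℕ) :
    ((n : ℝ) + 3) ^ 2 * r ^ n ≤ 9 := by
  induction n with
  | zero => norm_num
  | succ n ih =>
    have h1 : ((n : ℝ) + 1 + 3) ^ 2 * r ≤ ((n : ℝ) + 3) ^ 2 := by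
      nlinarith [Nat.cast_nonneg (α := ℝ) n, mul_le_mul_of_nonneg_left hr1 (sq_nonneg ((n:ℝ) + 4))]
    calc (((n + 1 : ℕ) : ℝ) + 3) ^ 2 * r ^ (n + 1) = (((n : ℝ) + 1 + 3) ^ 2 * r) * r ^ n := by
          push_cast; ring
      _ ≤ ((n : ℝ) + 3) ^ 2 * r ^ n := by gcongr
      _ ≤ 9 := ih

/-- For even `n` the two terms compete. Now `Q ≥ 2` forces `|t| < 1/2`, and `e ≤ n + 1` (that is, `c
≤ d`) bounds the coefficient by `(n + 1) ^ 2`; the leading term is at least `3/4` and the subtracted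
one stays below it. -/
lemma slopeSign_pos_of_two_le (hQ : 2 ≤ Q) (hn : 1 ≤ n) (he : 0 ≤ e) (hen : e ≤ n + 1)
    (ht : t ∈ Ioo (-Q⁻¹) 1) (ht0 : t < 0) : 0 < slopeSign Q n e t := by
  have hQ1 : 1 ≤ Q := by linarith
  rcases Nat.even_or_odd n with hev | hodd
  swap
  · exact slopeSign_pos_of_nonpos hQ1 ht
      (mul_nonpos_of_nonneg_of_nonpos he (hodd.pow_neg ht0).le)
  obtain ⟨k, rfl⟩ : ∃ k, n = k + 2 := by
    obtain ⟨j, rfl⟩ := hev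
    exact ⟨j + j - 2, by omega⟩
  obtain ⟨r, rfl⟩ : ∃ r, t = -r := ⟨-t, by ring⟩
  have hr0 : 0 < r := by linarith
  have hQr := one_add_mul_pos_of_mem hQ1 ht
  have hr2 : r < 1 / 2 := by nlinarith
  have e1 : (-r) ^ (k + 2) = r ^ (k + 2) := hev.neg_pow r
  have e2 : (-r) ^ (k + 2 + 1) = -r ^ (k + 2 + 1) := hev.add_one.neg_pow r
  have h9 := sq_mul_pow_le_nine hr0.le hr2.le k
  have hsq : r ^ (k + 2) ≤ r ^ 2 := pow_le_pow_of_le_one hr0.le (by linarith) (by omega)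
  have hpos : 0 < r ^ (k + 2 + 1) := by positivity
  have hlead : 3 / 4 ≤ (1 + Q * -r ^ (k + 2 + 1)) * (1 - -r ^ (k + 2 + 1)) := by
    have : Q * r ^ (k + 2 + 1) ≤ r ^ (k + 2) := by
      rw [pow_succ]
      have : 0 < r ^ (k + 2) := by positivity
      nlinarith
    have h34 : 3 / 4 ≤ 1 - Q * r ^ (k + 2 + 1) := by nlinarith
    nlinarith
  have hsecond : e * ((k + 2 : ℕ) + 1) * r ^ (k + 2) * ((1 + Q * -r) * (1 - -r)) ≤
      9 * (r ^ 2 * ((1 - 2 * r) * (1 + r))) := by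
    have hA : (1 + Q * -r) * (1 - -r) ≤ (1 - 2 * r) * (1 + r) := by
      rw [sub_neg_eq_add]
      apply mul_le_mul_of_nonneg_right _ (by linarith)
      nlinarith
    have hA0 : 0 ≤ (1 - 2 * r) * (1 + r) := mul_nonneg (by linarith) (by linarith)
    have hB0 : 0 ≤ (1 + Q * -r) * (1 - -r) := mul_nonneg hQr.le (by linarith)
    have hen' : e ≤ (k : ℝ) + 3 := by push_cast at hen; linarith
    calc e * ((k + 2 : ℕ) + 1) * r ^ (k + 2) * ((1 + Q * -r) * (1 - -r))
        ≤ ((k : ℝ) + 3) * ((k + 2 : ℕ) + 1) * r ^ (k + 2) * ((1 - 2 * r) * (1 + r)) := by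
          gcongr
      _ = (((k : ℝ) + 3) ^ 2 * r ^ k) * (r ^ 2 * ((1 - 2 * r) * (1 + r))) := by
          push_cast; ring
      _ ≤ 9 * (r ^ 2 * ((1 - 2 * r) * (1 + r))) := by gcongr
  have hfin : 9 * (r ^ 2 * ((1 - 2 * r) * (1 + r))) < 3 / 4 := by
    have h1 : r ^ 2 * ((1 - 2 * r) * (1 + r)) ≤ r * (1 - 2 * r) * (r * (1 + r)) := by
      apply le_of_eq; ring
    have h2 : r * (1 - 2 * r) ≤ 1 / 8 := by nlinarith [sq_nonneg (r - 1 / 4)]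
    -- The quartic on the left peaks near `r = 0.35` with value about `0.45`; the squares supplied
    -- vanish close to that point.
    nlinarith [sq_nonneg (r - 0.37), sq_nonneg (r ^ 2 + r / 4 - 0.22), sq_nonneg (r ^ 2 - 0.13)]
  unfold slopeSign
  rw [e1, e2]
  linarith

/-- `slopeSign Q n e t / ((1 - t) t ^ n)`, a convex function of `t > 0`. -/
noncomputable def reducedSlopeSign (Q : ℝ) (n : ℕ) (e t : ℝ) : ℝ :=
  (∑ j ∈ Finset.range (n + 1), (t⁻¹) ^ j) + Q * (∑ j ∈ Finset.range (n + 1), t ^ (j + 1)) -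
    e * (n + 1) * (1 + Q * t)

lemma slopeSign_eq_mul_reduced (ht : 0 < t) :
    slopeSign Q n e t = (1 - t) * t ^ n * reducedSlopeSign Q n e t := by
  have h1 : (∑ j ∈ Finset.range (n + 1), t ^ j) * (1 - t) = 1 - t ^ (n + 1) := by
    have := geom_sum_mul t (n + 1)
    linarith
  have h2 : t ^ n * (∑ j ∈ Finset.range (n + 1), (t⁻¹) ^ j) =
      ∑ j ∈ Finset.range (n + 1), t ^ j := by
    rw [Finset.mul_sum, ← Finset.sum_range_reflect]
    refine Finset.sum_congr rfl fun j hj => ?_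
    have hj' : j ≤ n := by simpa [Nat.lt_succ_iff] using hj
    rw [show n + 1 - 1 - j = n - j by omega, inv_pow, ← div_eq_mul_inv,
      div_eq_iff (by positivity), ← pow_add]
    congr 1; omega
  have h3 : ∑ j ∈ Finset.range (n + 1), t ^ (j + 1) =
      t * ∑ j ∈ Finset.range (n + 1), t ^ j := by
    rw [Finset.mul_sum]; exact Finset.sum_congr rfl fun j _ => by ring
  unfold reducedSlopeSign slopeSign
  rw [h3]
  set G := ∑ j ∈ Finset.range (n + 1), t ^ j
  set I := ∑ j ∈ Finset.range (n + 1), (t⁻¹) ^ j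
  calc _ = (1 + Q * t ^ (n + 1)) * (G * (1 - t)) -
        e * (n + 1) * t ^ n * ((1 + Q * t) * (1 - t)) := by rw [h1]
    _ = (1 - t) * (G + t ^ n * (Q * (t * G)) - t ^ n * (e * (n + 1) * (1 + Q * t))) := by ring
    _ = _ := by rw [← h2]; ring

lemma convexOn_reducedSlopeSign (hQ : 0 ≤ Q) :
    ConvexOn ℝ (Ioi 0) (reducedSlopeSign Q n e) := by
  have hsum : ∀ (f : ℕ → ℝ → ℝ) (s : Finset ℕ), (∀ j, ConvexOn ℝ (Ioi (0:ℝ)) (f j)) →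
      ConvexOn ℝ (Ioi (0:ℝ)) (fun t => ∑ j ∈ s, f j t) := by
    intro f s hf
    induction s using Finset.induction_on with
    | empty => simpa using convexOn_const (0:ℝ) (convex_Ioi (0:ℝ))
    | insert a s ha ih => simp only [Finset.sum_insert ha]; exact (hf a).add ih
  have h1 := hsum (fun j t => (t⁻¹) ^ j) (Finset.range (n + 1)) fun j => by
    have := convexOn_zpow (𝕜 := ℝ) (-(j : ℤ))
    simpa [zpow_neg, ← inv_pow] using this
  have h2 := hsum (fun j t => t ^ (j + 1)) (Finset.range (n + 1)) fun j =>
    (convexOn_pow (𝕜 := ℝ) (j + 1)).subset Ioi_subset_Ici_self (convex_Ioi 0)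
  have h3 : ConvexOn ℝ (Ioi (0:ℝ)) (fun t => -(e * (n + 1) * (1 + Q * t))) := by
    refine ⟨convex_Ioi 0, fun x _ y _ a b _ _ hab => le_of_eq ?_⟩
    simp only [smul_eq_mul]
    obtain rfl : b = 1 - a := by linarith
    ring
  have := (h1.add (h2.smul hQ)).add h3
  refine this.congr fun t _ => ?_
  simp [reducedSlopeSign, sub_eq_add_neg]

lemma reducedSlopeSign_one : reducedSlopeSign Q n e 1 = (n + 1) * (1 + Q) * (1 - e) := by
  simp [reducedSlopeSign]; ring

/-- For `e > 1` the value at `1` is already negative. For `e = 1` it is `0`, but the derivative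
there is `(Q - 1) n (n + 1) / 2 > 0`, so the function is negative just left of `1`. -/
lemma exists_reducedSlopeSign_neg (hQ : 1 ≤ Q) (hn : 1 ≤ n) (he : 1 < e ∨ e = 1 ∧ 1 < Q) :
    ∃ b ∈ Ioo (0 : ℝ) 1, reducedSlopeSign Q n e b < 0 := by
  have hd : HasDerivAt (reducedSlopeSign Q n e)
      ((∑ j ∈ Finset.range (n + 1), -(j : ℝ)) + Q * (∑ j ∈ Finset.range (n + 1), ((j : ℝ) + 1)) -
        e * (n + 1) * Q) 1 := by
    have h1 : HasDerivAt (fun t : ℝ => ∑ j ∈ Finset.range (n + 1), (t⁻¹) ^ j)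
        (∑ j ∈ Finset.range (n + 1), -(j : ℝ)) 1 := by
      refine HasDerivAt.fun_sum fun j _ => ?_
      simpa using (hasDerivAt_inv (one_ne_zero (α := ℝ))).fun_pow j
    have h2 : HasDerivAt (fun t : ℝ => ∑ j ∈ Finset.range (n + 1), t ^ (j + 1))
        (∑ j ∈ Finset.range (n + 1), ((j : ℝ) + 1)) 1 := by
      refine HasDerivAt.fun_sum fun j _ => ?_
      simpa using hasDerivAt_pow (j + 1) (1 : ℝ)
    have h3 : HasDerivAt (fun t : ℝ => e * (n + 1) * (1 + Q * t)) (e * (n + 1) * Q) 1 := by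
      simpa using (((hasDerivAt_id (1:ℝ)).const_mul Q).const_add 1).const_mul (e * (n + 1))
    exact (h1.add (h2.const_mul Q)).sub h3
  have hIoo : ∀ᶠ b in 𝓝[<] (1:ℝ), b ∈ Ioo (0:ℝ) 1 := Ioo_mem_nhdsLT one_pos
  rcases he with he | ⟨rfl, hQ'⟩
  · have hneg : reducedSlopeSign Q n e 1 < 0 := by
      rw [reducedSlopeSign_one]
      exact mul_neg_of_pos_of_neg (by positivity) (by linarith)
    have := (hd.continuousAt.eventually_lt_const hneg).filter_mono
      (nhdsWithin_le_nhds (s := Iio 1))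
    obtain ⟨b, hb, hb'⟩ := (this.and hIoo).exists
    exact ⟨b, hb', hb⟩
  · have hsum : (1:ℝ) ≤ ∑ j ∈ Finset.range (n + 1), (j : ℝ) := by
      have := Finset.single_le_sum (f := fun j : ℕ => (j : ℝ)) (s := Finset.range (n + 1))
        (fun j _ => Nat.cast_nonneg j) (Finset.mem_range.2 (by omega : 1 < n + 1))
      simpa using this
    have hpos : 0 < (∑ j ∈ Finset.range (n + 1), -(j : ℝ)) +
        Q * (∑ j ∈ Finset.range (n + 1), ((j : ℝ) + 1)) - 1 * (n + 1) * Q := by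
      rw [Finset.sum_neg_distrib, Finset.sum_add_distrib]
      simp only [Finset.sum_const, Finset.card_range, nsmul_eq_mul, mul_one]
      push_cast
      nlinarith
    have h0 : reducedSlopeSign Q n 1 1 = 0 := by rw [reducedSlopeSign_one]; ring
    have hev := (hasDerivAt_iff_tendsto_slope.1 hd).eventually_const_lt hpos
    have hev' : ∀ᶠ b in 𝓝[<] (1:ℝ), 0 < slope (reducedSlopeSign Q n 1) 1 b :=
      hev.filter_mono (nhdsWithin_mono _ fun x hx => ne_of_lt hx)
    obtain ⟨b, hb, hb'⟩ := (hev'.and hIoo).exists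
    refine ⟨b, hb', ?_⟩
    rw [slope_def_field, h0, sub_zero] at hb
    by_contra hcon
    exact absurd hb (not_lt.2 (div_nonpos_of_nonneg_of_nonpos (not_lt.1 hcon)
      (by linarith [hb'.2])))

/-- On `[0, 1)` the sign changes exactly once, from positive to negative. -/
lemma exists_slopeSign_change (hQ : 1 ≤ Q) (hn : 1 ≤ n) (he : 1 < e ∨ e = 1 ∧ 1 < Q) :
    ∃ a ∈ Ioo (0 : ℝ) 1, (∀ t ∈ Ico 0 a, 0 < slopeSign Q n e t) ∧
      ∀ t ∈ Ioo a 1, slopeSign Q n e t < 0 := by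
  obtain ⟨b, hb, hFb⟩ := exists_reducedSlopeSign_neg hQ hn he
  have hconv := convexOn_reducedSlopeSign (n := n) (e := e) (by linarith : 0 ≤ Q)
  have hfac : ∀ t ∈ Ioo (0:ℝ) 1, 0 < (1 - t) * t ^ n := fun t ht =>
    mul_pos (sub_pos.2 ht.2) (pow_pos ht.1 n)
  have h0 : slopeSign Q n e 0 = 1 := by simp [slopeSign, show n ≠ 0 by omega]
  have hNb : slopeSign Q n e b < 0 := by
    rw [slopeSign_eq_mul_reduced hb.1]
    exact mul_neg_of_pos_of_neg (hfac b hb) hFb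
  have hcont : Continuous (slopeSign Q n e) := by unfold slopeSign; fun_prop
  obtain ⟨a, ha, hNa⟩ : (0:ℝ) ∈ slopeSign Q n e '' Icc 0 b :=
    intermediate_value_Icc' hb.1.le hcont.continuousOn ⟨hNb.le, by rw [h0]; norm_num⟩
  have ha0 : 0 < a := ha.1.lt_of_ne (by rintro rfl; rw [h0] at hNa; norm_num at hNa)
  have hab : a < b := ha.2.lt_of_ne (by rintro rfl; exact hNb.ne hNa)
  have ha1 : a < 1 := hab.trans hb.2
  have hFa : reducedSlopeSign Q n e a = 0 := by
    rw [slopeSign_eq_mul_reduced ha0] at hNa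
    exact (mul_eq_zero.1 hNa).resolve_left (hfac a ⟨ha0, ha1⟩).ne'
  have hF1 : reducedSlopeSign Q n e 1 ≤ 0 := by
    rw [reducedSlopeSign_one]
    refine mul_nonpos_of_nonneg_of_nonpos (by positivity) ?_
    rcases he with h | h <;> linarith [h]
  -- Convexity in three-point form. With a zero at `a`, a negative value at `b > a` and a
  -- nonpositive value at `1`, it forces positivity left of `a` and negativity on all of `(a, 1)`.
  have hchord : ∀ {x y z : ℝ}, 0 < x → x < y → y < z →
      (z - x) * reducedSlopeSign Q n e y ≤
        (z - y) * reducedSlopeSign Q n e x + (y - x) * reducedSlopeSign Q n e z := by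
    intro x y z hx hxy hyz
    have := hconv.slope_mono_adjacent (mem_Ioi.2 hx) (mem_Ioi.2 (hx.trans (hxy.trans hyz))) hxy hyz
    rw [div_le_div_iff₀ (by linarith) (by linarith)] at this
    nlinarith
  refine ⟨a, ⟨ha0, ha1⟩, fun t ht => ?_, fun t ht => ?_⟩
  · rcases ht.1.eq_or_lt with rfl | ht0
    · rw [h0]; norm_num
    · rw [slopeSign_eq_mul_reduced ht0]
      refine mul_pos (hfac t ⟨ht0, ht.2.trans ha1⟩) ?_
      have := hchord ht0 ht.2 hab
      rw [hFa] at this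
      have h2 : (a - t) * reducedSlopeSign Q n e b < 0 :=
        mul_neg_of_pos_of_neg (by linarith [ht.2]) hFb
      exact pos_of_mul_pos_right (by linarith : 0 < (b - a) * reducedSlopeSign Q n e t)
        (by linarith)
  · have ht0 : 0 < t := ha0.trans ht.1
    rw [slopeSign_eq_mul_reduced ht0]
    refine mul_neg_of_pos_of_neg (hfac t ⟨ht0, ht.2⟩) ?_
    rcases lt_trichotomy t b with h | rfl | h
    · have := hchord ha0 ht.1 h
      rw [hFa] at this
      have h2 : (t - a) * reducedSlopeSign Q n e b < 0 :=
        mul_neg_of_pos_of_neg (by linarith [ht.1]) hFb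
      exact neg_of_mul_neg_right (by linarith : (b - a) * reducedSlopeSign Q n e t < 0)
        (by linarith)
    · exact hFb
    · have := hchord hb.1 h ht.2
      have h2 : (1 - t) * reducedSlopeSign Q n e b < 0 :=
        mul_neg_of_pos_of_neg (by linarith [ht.2]) hFb
      have h3 : (t - b) * reducedSlopeSign Q n e 1 ≤ 0 :=
        mul_nonpos_of_nonneg_of_nonpos (by linarith) hF1
      exact neg_of_mul_neg_right (by linarith : (1 - b) * reducedSlopeSign Q n e t < 0)
        (by linarith [hb.2])

end Elementary

/-! ### Calculus of the slope, the critical point and the potential. -/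

/-- `L(t) = ln ((1 + Q t) / (1 - t))`. -/
noncomputable def logOdds (Q t : ℝ) : ℝ := Real.log (1 + Q * t) - Real.log (1 - t)

/-- `L(t) - e L(t ^ (n + 1))`: with `e = c - 1`, the derivative of the growth rate at the point whose
minimiser has parameter `t`. -/
noncomputable def growthSlope (Q : ℝ) (n : ℕ) (e t : ℝ) : ℝ :=
  logOdds Q t - e * logOdds Q (t ^ (n + 1))

/-- The point `x` at which `potential Q n x` is minimal at the parameter `t`. -/
noncomputable def critPoint (Q : ℝ) (n : ℕ) (t : ℝ) : ℝ :=
  Q / (Q + 1) * ((1 - t) * (1 - t ^ (n + 1)) / (1 + Q * t ^ (n + 2)))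

/-- The part of `deltaTwo` that depends on `t = 1 - q y / (q - 1)`, for `Q = q - 1`, `d = n + 2`. -/
noncomputable def potential (Q : ℝ) (n : ℕ) (x t : ℝ) : ℝ :=
  Real.log (1 + Q * t ^ (n + 2)) - (n + 2) * x * Real.log (1 - t) -
    (n + 2) * (1 - x) * Real.log (1 + Q * t)

section Calculus

variable {Q t e x : ℝ} {n : ℕ}

lemma logOdds_zero : logOdds Q 0 = 0 := by simp [logOdds]

lemma growthSlope_zero : growthSlope Q n e 0 = 0 := by simp [growthSlope, logOdds_zero]

lemma hasDerivAt_logOdds (h1 : 0 < 1 + Q * t) (h2 : t < 1) :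
    HasDerivAt (logOdds Q) ((Q + 1) / ((1 + Q * t) * (1 - t))) t := by
  have h3 : 1 - t ≠ 0 := by linarith
  have hA : HasDerivAt (fun t => Real.log (1 + Q * t)) (Q / (1 + Q * t)) t := by
    have : HasDerivAt (fun t : ℝ => 1 + Q * t) Q t := by
      simpa using ((hasDerivAt_id t).const_mul Q).const_add 1
    exact this.log h1.ne'
  have hB : HasDerivAt (fun t => Real.log (1 - t)) (-1 / (1 - t)) t := by
    have : HasDerivAt (fun t : ℝ => 1 - t) (-1) t := by
      simpa using (hasDerivAt_id t).const_sub 1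
    exact this.log h3
  refine (hA.sub hB).congr_deriv ?_
  have := h1.ne'
  field_simp
  ring

lemma hasDerivAt_growthSlope (hQ : 1 ≤ Q) (ht : t ∈ Ioo (-Q⁻¹) 1) :
    HasDerivAt (growthSlope Q n e) ((Q + 1) * slopeSign Q n e t /
      (((1 + Q * t) * (1 - t)) * ((1 + Q * t ^ (n + 1)) * (1 - t ^ (n + 1))))) t := by
  have h1 := one_add_mul_pos_of_mem hQ ht
  have h2 : 0 < 1 - t := sub_pos.2 ht.2
  have h3 := one_add_pow_mul_pos hQ ht n
  have h4 : 0 < 1 - t ^ (n + 1) := sub_pos.2 (pow_succ_mem hQ ht n).2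
  have hA := hasDerivAt_logOdds h1 ht.2
  have hB := HasDerivAt.comp (h₂ := logOdds Q) (h := fun s => s ^ (n + 1)) t
    (hasDerivAt_logOdds h3 (pow_succ_mem hQ ht n).2) (hasDerivAt_pow (n + 1) t)
  refine (hA.sub (hB.const_mul e)).congr_deriv ?_
  unfold slopeSign
  have := h1.ne'; have := h2.ne'; have := h3.ne'; have := h4.ne'
  simp only [Nat.add_sub_cancel]
  push_cast
  field_simp

lemma growthSlope_deriv_factor_pos (hQ : 1 ≤ Q) (ht : t ∈ Ioo (-Q⁻¹) 1) :
    0 < ((1 + Q * t) * (1 - t)) * ((1 + Q * t ^ (n + 1)) * (1 - t ^ (n + 1))) :=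
  mul_pos (mul_pos (one_add_mul_pos_of_mem hQ ht) (sub_pos.2 ht.2)) (slopeSign_leading_pos hQ ht)

lemma continuousOn_growthSlope (hQ : 1 ≤ Q) :
    ContinuousOn (growthSlope Q n e) (Ioo (-Q⁻¹) 1) := fun _ ht =>
  (hasDerivAt_growthSlope hQ ht).continuousAt.continuousWithinAt

lemma growthSlope_strictMonoOn (hQ : 1 ≤ Q) {s : Set ℝ} (hs : Convex ℝ s)
    (hsub : s ⊆ Ioo (-Q⁻¹) 1) (h : ∀ t ∈ interior s, 0 < slopeSign Q n e t) :
    StrictMonoOn (growthSlope Q n e) s := by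
  refine strictMonoOn_of_deriv_pos hs ((continuousOn_growthSlope hQ).mono hsub) fun t ht => ?_
  have hT := hsub (interior_subset ht)
  rw [(hasDerivAt_growthSlope hQ hT).deriv]
  exact div_pos (mul_pos (by linarith) (h t ht)) (growthSlope_deriv_factor_pos hQ hT)

lemma growthSlope_monotoneOn (hQ : 1 ≤ Q) {s : Set ℝ} (hs : Convex ℝ s)
    (hsub : s ⊆ Ioo (-Q⁻¹) 1) (h : ∀ t ∈ interior s, 0 ≤ slopeSign Q n e t) :
    MonotoneOn (growthSlope Q n e) s := by
  refine monotoneOn_of_deriv_nonneg hs ((continuousOn_growthSlope hQ).mono hsub)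
    (fun t ht => (hasDerivAt_growthSlope hQ
      (hsub (interior_subset ht))).differentiableAt.differentiableWithinAt) fun t ht => ?_
  have hT := hsub (interior_subset ht)
  rw [(hasDerivAt_growthSlope hQ hT).deriv]
  exact div_nonneg (mul_nonneg (by linarith) (h t ht)) (growthSlope_deriv_factor_pos hQ hT).le

lemma growthSlope_strictAntiOn (hQ : 1 ≤ Q) {s : Set ℝ} (hs : Convex ℝ s)
    (hsub : s ⊆ Ioo (-Q⁻¹) 1) (h : ∀ t ∈ interior s, slopeSign Q n e t < 0) :
    StrictAntiOn (growthSlope Q n e) s := by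
  refine strictAntiOn_of_deriv_neg hs ((continuousOn_growthSlope hQ).mono hsub) fun t ht => ?_
  have hT := hsub (interior_subset ht)
  rw [(hasDerivAt_growthSlope hQ hT).deriv]
  exact div_neg_of_neg_of_pos (mul_neg_of_pos_of_neg (by linarith) (h t ht))
    (growthSlope_deriv_factor_pos hQ hT)

lemma logOdds_strictMonoOn (hQ : 1 ≤ Q) : StrictMonoOn (logOdds Q) (Ioo (-Q⁻¹) 1) := by
  have h := growthSlope_strictMonoOn (n := 0) (e := 0) hQ (convex_Ioo (-Q⁻¹) 1) Subset.rfl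
    fun t ht => slopeSign_pos_of_nonpos hQ (interior_subset ht) (by simp)
  have he : growthSlope Q 0 0 = logOdds Q := by ext; simp [growthSlope]
  rwa [he] at h

lemma critPoint_zero : critPoint Q n 0 = Q / (Q + 1) := by simp [critPoint]

/-- Like `critPoint` itself, its complement factors into a part in `t` and the same part in `t ^ (n
+ 1)`, over the same denominator. This is why the log-odds below split into two values of `logOdds`.
-/
lemma one_sub_critPoint (hQ : 1 ≤ Q) (h : 1 + Q * t ^ (n + 2) ≠ 0) :
    1 - critPoint Q n t =
      (1 / (Q + 1)) * ((1 + Q * t) * (1 + Q * t ^ (n + 1)) / (1 + Q * t ^ (n + 2))) := by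
  have : Q + 1 ≠ 0 := by linarith
  unfold critPoint
  field_simp
  ring

lemma critPoint_mem_Ioo (hQ : 1 ≤ Q) (ht : t ∈ Ioo (-Q⁻¹) 1) : critPoint Q n t ∈ Ioo 0 1 := by
  have h0 := one_add_pow_mul_pos hQ ht (n + 1)
  have h1 := one_add_mul_pos_of_mem hQ ht
  have h2 : 0 < 1 - t := sub_pos.2 ht.2
  have h3 := one_add_pow_mul_pos hQ ht n
  have h4 : 0 < 1 - t ^ (n + 1) := sub_pos.2 (pow_succ_mem hQ ht n).2
  constructor
  · unfold critPoint
    exact mul_pos (div_pos (by linarith) (by linarith)) (div_pos (mul_pos h2 h4) h0)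
  · rw [← sub_pos, one_sub_critPoint hQ h0.ne']
    exact mul_pos (div_pos one_pos (by linarith)) (div_pos (mul_pos h1 h3) h0)

lemma log_odds_critPoint (hQ : 1 ≤ Q) (ht : t ∈ Ioo (-Q⁻¹) 1) :
    Real.log Q + Real.log (1 - critPoint Q n t) - Real.log (critPoint Q n t) =
      growthSlope Q n (-1) t := by
  have h0 := one_add_pow_mul_pos hQ ht (n + 1)
  have h1 := one_add_mul_pos_of_mem hQ ht
  have h2 : 0 < 1 - t := sub_pos.2 ht.2
  have h3 := one_add_pow_mul_pos hQ ht n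
  have h4 : 0 < 1 - t ^ (n + 1) := sub_pos.2 (pow_succ_mem hQ ht n).2
  rw [one_sub_critPoint hQ h0.ne']
  unfold critPoint growthSlope logOdds
  have hq : 0 < Q + 1 := by linarith
  have hQ0 : 0 < Q := by linarith
  rw [Real.log_mul (by positivity) (by positivity), Real.log_mul (by positivity) (by positivity),
    Real.log_div (by positivity) (by positivity), Real.log_div (by positivity) (by positivity),
    Real.log_div (by positivity) (by positivity), Real.log_div (by positivity) (by positivity),
    Real.log_mul (by positivity) (by positivity), Real.log_mul (by positivity) (by positivity),
    Real.log_one]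
  ring

/-- The sign is found without computing the derivative: `log_odds_critPoint` is differentiated, and
the log-odds on its left is a decreasing function of `critPoint`. -/
lemma hasDerivAt_critPoint (hQ : 1 ≤ Q) (hn : 1 ≤ n) (ht : t ∈ Ioo (-Q⁻¹) 1) :
    ∃ v < 0, HasDerivAt (critPoint Q n) v t := by
  have hd : DifferentiableAt ℝ (critPoint Q n) t := by
    unfold critPoint
    have := (one_add_pow_mul_pos hQ ht (n + 1)).ne'
    fun_prop (disch := assumption)
  refine ⟨_, ?_, hd.hasDerivAt⟩
  obtain ⟨hX0, hX1⟩ := critPoint_mem_Ioo (n := n) hQ ht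
  have hY0 : 0 < 1 - critPoint Q n t := by linarith
  have hL : HasDerivAt (fun s => Real.log Q + Real.log (1 - critPoint Q n s) -
      Real.log (critPoint Q n s)) (-deriv (critPoint Q n) t / (1 - critPoint Q n t) -
        deriv (critPoint Q n) t / critPoint Q n t) t :=
    (((hd.hasDerivAt.const_sub 1).log hY0.ne').const_add _).sub (hd.hasDerivAt.log hX0.ne')
  have hEq : (fun s => Real.log Q + Real.log (1 - critPoint Q n s) -
      Real.log (critPoint Q n s)) =ᶠ[𝓝 t] growthSlope Q n (-1) := by
    filter_upwards [isOpen_Ioo.mem_nhds ht] with s hs using log_odds_critPoint hQ hs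
  have huniq := hL.unique ((hasDerivAt_growthSlope (n := n) (e := -1) hQ ht).congr_of_eventuallyEq
    hEq)
  have hpos : 0 < (Q + 1) * slopeSign Q n (-1) t /
      (((1 + Q * t) * (1 - t)) * ((1 + Q * t ^ (n + 1)) * (1 - t ^ (n + 1)))) :=
    div_pos (mul_pos (by linarith) (slopeSign_neg_one_pos hQ hn ht))
      (growthSlope_deriv_factor_pos hQ ht)
  rw [← huniq] at hpos
  by_contra hcon
  have h1 := div_nonneg (not_lt.1 hcon) hY0.le
  have h2 := div_nonneg (not_lt.1 hcon) hX0.le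
  rw [neg_div] at hpos
  linarith

lemma critPoint_strictAntiOn (hQ : 1 ≤ Q) (hn : 1 ≤ n) :
    StrictAntiOn (critPoint Q n) (Ioo (-Q⁻¹) 1) := by
  refine strictAntiOn_of_deriv_neg (convex_Ioo _ _) (fun t ht => ?_) fun t ht => ?_
  · obtain ⟨v, -, hv⟩ := hasDerivAt_critPoint hQ hn ht
    exact hv.continuousAt.continuousWithinAt
  · obtain ⟨v, hv0, hv⟩ := hasDerivAt_critPoint hQ hn (interior_subset ht)
    rwa [hv.deriv]

lemma hasDerivAt_potential (hQ : 1 ≤ Q) (ht : t ∈ Ioo (-Q⁻¹) 1) :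
    HasDerivAt (potential Q n x)
      ((n + 2) * (Q + 1) / ((1 - t) * (1 + Q * t)) * (x - critPoint Q n t)) t := by
  have h0 := one_add_pow_mul_pos hQ ht (n + 1)
  have h1 := one_add_mul_pos_of_mem hQ ht
  have h2 : 0 < 1 - t := sub_pos.2 ht.2
  have hA : HasDerivAt (fun t => Real.log (1 + Q * t ^ (n + 2)))
      (Q * ((n + 2) * t ^ (n + 1)) / (1 + Q * t ^ (n + 2))) t := by
    have : HasDerivAt (fun t : ℝ => 1 + Q * t ^ (n + 2)) (Q * ((n + 2) * t ^ (n + 1))) t := by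
      simpa using ((hasDerivAt_pow (n + 2) t).const_mul Q).const_add 1
    exact this.log h0.ne'
  have hB : HasDerivAt (fun t => Real.log (1 + Q * t)) (Q / (1 + Q * t)) t := by
    have : HasDerivAt (fun t : ℝ => 1 + Q * t) Q t := by
      simpa using ((hasDerivAt_id t).const_mul Q).const_add 1
    exact this.log h1.ne'
  have hC : HasDerivAt (fun t => Real.log (1 - t)) (-1 / (1 - t)) t := by
    have : HasDerivAt (fun t : ℝ => 1 - t) (-1) t := by
      simpa using (hasDerivAt_id t).const_sub 1
    exact this.log h2.ne'
  refine ((hA.sub (hC.const_mul ((n + 2) * x))).sub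
    (hB.const_mul ((n + 2) * (1 - x)))).congr_deriv ?_
  unfold critPoint
  have := h0.ne'; have := h1.ne'; have := h2.ne'
  have : Q + 1 ≠ 0 := by linarith
  field_simp
  ring

/-- Generically the denominator is positive at `-Q⁻¹` and `1 + Q t` vanishes there, so the limit is
`1`. For `Q = 1` and odd `n` the formula for `1 - critPoint` is `0 / 0`; cancelling `1 + t` leaves
an alternating geometric sum equal to `n + 2` at `-1`, whence `1 - 1 / (n + 2)`. -/
lemma tendsto_critPoint_left (hQ : 1 ≤ Q) {b : ℝ}
    (hb : b = if Q = 1 ∧ Odd n then 1 - 1 / ((n : ℝ) + 2) else 1)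
    (hQ2 : Q = 1 ∨ 2 ≤ Q) (hn : 1 ≤ n) :
    Tendsto (critPoint Q n) (𝓝[>] (-Q⁻¹)) (𝓝 b) := by
  have hQ0 : 0 < Q := by linarith
  by_cases hsp : Q = 1 ∧ Odd n
  · obtain ⟨rfl, hodd⟩ := hsp
    have hodd2 : Odd (n + 2) := by obtain ⟨k, rfl⟩ := hodd; exact ⟨k + 1, by ring⟩
    rw [if_pos ⟨rfl, hodd⟩] at hb
    set G : ℝ → ℝ := fun t => ∑ j ∈ Finset.range (n + 2), (-t) ^ j with hG
    have hgeom : ∀ t, G t * (1 + t) = 1 + t ^ (n + 2) := fun t => by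
      have := geom_sum_mul (-t) (n + 2)
      rw [hodd2.neg_pow] at this
      simp only [hG]; linarith
    have hG1 : G (-1) = n + 2 := by simp [hG]
    have hev : (fun t => 1 - 1 / 2 * ((1 + t ^ (n + 1)) / G t)) =ᶠ[𝓝[>] (-(1:ℝ)⁻¹)]
        critPoint 1 n := by
      filter_upwards [Ioo_mem_nhdsGT (show -(1:ℝ)⁻¹ < 1 by norm_num)] with t ht
      have h0 := one_add_pow_mul_pos hQ ht (n + 1)
      have h1 := one_add_mul_pos_of_mem hQ ht
      rw [one_mul] at h0 h1
      have := one_sub_critPoint (n := n) hQ (by rw [one_mul]; exact h0.ne')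
      have h2 : (1 + t ^ (n + 1)) / G t =
          (1 + t) * (1 + t ^ (n + 1)) / (1 + t ^ (n + 2)) := by
        rw [← hgeom, mul_comm (G t), mul_div_mul_left _ _ h1.ne']
      rw [h2]
      simp only [one_mul] at this
      norm_num at this ⊢
      linarith
    refine Tendsto.congr' hev ?_
    have hcont : ContinuousAt (fun t => 1 - 1 / 2 * ((1 + t ^ (n + 1)) / G t)) (-(1:ℝ)⁻¹) := by
      have : G (-(1:ℝ)⁻¹) ≠ 0 := by rw [inv_one, hG1]; positivity
      have hGc : Continuous G := by simp only [hG]; fun_prop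
      fun_prop (disch := assumption)
    have := hcont.tendsto.mono_left (nhdsWithin_le_nhds (s := Ioi (-(1:ℝ)⁻¹)))
    convert this using 2
    rw [hb, inv_one, hG1, hodd.add_one.neg_one_pow]
    field_simp
    ring
  · rw [if_neg hsp] at hb
    have hpos : 0 < 1 + Q * (-Q⁻¹) ^ (n + 2) := by
      rcases Nat.even_or_odd n with hev | hodd
      · have : Even (n + 2) := by obtain ⟨k, rfl⟩ := hev; exact ⟨k + 1, by ring⟩
        have := this.pow_nonneg (-Q⁻¹)
        positivity
      · have hQ' : 2 ≤ Q := hQ2.resolve_left fun h => hsp ⟨h, hodd⟩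
        have hmem : -Q⁻¹ < (-Q⁻¹) ^ (n + 2) := by
          have hodd2 : Odd (n + 2) := by obtain ⟨k, rfl⟩ := hodd; exact ⟨k + 1, by ring⟩
          rw [hodd2.neg_pow, neg_lt_neg_iff]
          exact pow_lt_self_of_lt_one₀ (by positivity) (inv_lt_one_of_one_lt₀ (by linarith))
            (by omega)
        have := mul_lt_mul_of_pos_left hmem hQ0
        rw [mul_neg, mul_inv_cancel₀ hQ0.ne'] at this
        linarith
    have hcont : ContinuousAt (critPoint Q n) (-Q⁻¹) := by
      unfold critPoint
      have := hpos.ne'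
      fun_prop (disch := assumption)
    have := hcont.tendsto.mono_left (nhdsWithin_le_nhds (s := Ioi (-Q⁻¹)))
    convert this using 2
    have h1 := one_sub_critPoint (n := n) hQ hpos.ne'
    have h2 : 1 + Q * -Q⁻¹ = 0 := by rw [mul_neg, mul_inv_cancel₀ hQ0.ne']; ring
    rw [h2] at h1
    simp at h1
    linarith

lemma tendsto_critPoint_right (hQ : 1 ≤ Q) : Tendsto (critPoint Q n) (𝓝[<] 1) (𝓝 0) := by
  have hcont : ContinuousAt (critPoint Q n) 1 := by
    unfold critPoint
    have : 1 + Q * 1 ^ (n + 2) ≠ 0 := by rw [one_pow]; linarith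
    fun_prop (disch := assumption)
  have := hcont.tendsto.mono_left (nhdsWithin_le_nhds (s := Iio 1))
  convert this using 2
  simp [critPoint]

lemma critPoint_image (hQ : 1 ≤ Q) {b : ℝ}
    (hb : b = if Q = 1 ∧ Odd n then 1 - 1 / ((n : ℝ) + 2) else 1)
    (hQ2 : Q = 1 ∨ 2 ≤ Q) (hn : 1 ≤ n) :
    critPoint Q n '' Ioo (-Q⁻¹) 1 = Ioo 0 b := by
  have hanti := critPoint_strictAntiOn hQ hn
  have hlim := tendsto_critPoint_left hQ hb hQ2 hn
  have hne : -Q⁻¹ < 1 := (zero_mem_Ioo_neg_inv hQ).1.trans one_pos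
  apply Subset.antisymm
  · rintro _ ⟨t, ht, rfl⟩
    refine ⟨(critPoint_mem_Ioo hQ ht).1, ?_⟩
    obtain ⟨s, hs1, hs2⟩ := exists_between ht.1
    have hs : s ∈ Ioo (-Q⁻¹) 1 := ⟨hs1, hs2.trans ht.2⟩
    refine (hanti hs ht hs2).trans_le (ge_of_tendsto hlim ?_)
    filter_upwards [Ioo_mem_nhdsGT hs1] with r hr
    exact (hanti ⟨hr.1, hr.2.trans hs.2⟩ hs hr.2).le
  · refine isPreconnected_Ioo.intermediate_value_Ioo (l₁ := 𝓝[<] 1) (l₂ := 𝓝[>] (-Q⁻¹))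
      (le_principal_iff.2 (Ioo_mem_nhdsLT hne)) (le_principal_iff.2 (Ioo_mem_nhdsGT hne))
      (fun t ht => ?_) (tendsto_critPoint_right hQ) hlim
    obtain ⟨v, -, hv⟩ := hasDerivAt_critPoint hQ hn ht
    exact hv.continuousAt.continuousWithinAt

end Calculus

/-! ### Infima of affine families: boundedness and continuity at the endpoints. -/

/-- The infimum of `potential Q n x` over all admissible parameters. -/
noncomputable def minPotential (Q : ℝ) (n : ℕ) (x : ℝ) : ℝ :=
  sInf (potential Q n x '' Ioo (-Q⁻¹) 1)

section AffineInfimum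

variable {T : Set ℝ} {α β : ℝ → ℝ} {b x : ℝ}

lemma bddBelow_affine_image (h0 : BddBelow (α '' T))
    (hb : BddBelow ((fun t => α t + b * β t) '' T)) (hb0 : 0 < b) (hx : x ∈ Icc 0 b) :
    BddBelow ((fun t => α t + x * β t) '' T) := by
  obtain ⟨u, hu⟩ := h0
  obtain ⟨v, hv⟩ := hb
  refine ⟨(1 - x / b) * u + x / b * v, ?_⟩
  rintro _ ⟨t, ht, rfl⟩
  have h1 := hu (mem_image_of_mem _ ht)
  have h2 := hv (mem_image_of_mem _ ht)
  have h3 : 0 ≤ x / b := div_nonneg hx.1 hb0.le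
  have h4 : x / b ≤ 1 := (div_le_one hb0).2 hx.2
  have h5 : α t + x * β t = (1 - x / b) * α t + x / b * (α t + b * β t) := by
    field_simp; ring
  simp only at h2 ⊢
  rw [h5]
  exact add_le_add (mul_le_mul_of_nonneg_left h1 (by linarith)) (mul_le_mul_of_nonneg_left h2 h3)

/-- The infimum is concave in `x`, so it lies above its chord on `[0, b]`; from above it is
controlled by a single affine member that is nearly minimal at `0`. -/
lemma continuousWithinAt_sInf_affine_left (hT : T.Nonempty) (h0 : BddBelow (α '' T))
    (hb : BddBelow ((fun t => α t + b * β t) '' T)) (hb0 : 0 < b) :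
    ContinuousWithinAt (fun x => sInf ((fun t => α t + x * β t) '' T)) (Icc 0 b) 0 := by
  set g := fun x => sInf ((fun t => α t + x * β t) '' T) with hg
  have hle : ∀ x ∈ Icc 0 b, ∀ t ∈ T, g x ≤ α t + x * β t := fun x hx t ht =>
    csInf_le (bddBelow_affine_image h0 hb hb0 hx) (mem_image_of_mem _ ht)
  have h00 : (0:ℝ) ∈ Icc 0 b := ⟨le_rfl, hb0.le⟩
  have hbb : b ∈ Icc 0 b := ⟨hb0.le, le_rfl⟩
  have hlower : ∀ x ∈ Icc 0 b, (1 - x / b) * g 0 + x / b * g b ≤ g x := by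
    intro x hx
    refine le_csInf (hT.image _) ?_
    rintro _ ⟨t, ht, rfl⟩
    have h1 := hle 0 h00 t ht
    have h2 := hle b hbb t ht
    have h3 : 0 ≤ x / b := div_nonneg hx.1 hb0.le
    have h4 : x / b ≤ 1 := (div_le_one hb0).2 hx.2
    have h5 : α t + x * β t = (1 - x / b) * (α t + 0 * β t) + x / b * (α t + b * β t) := by
      field_simp; ring
    simp only
    rw [h5]
    exact add_le_add (mul_le_mul_of_nonneg_left h1 (by linarith)) (mul_le_mul_of_nonneg_left h2 h3)
  refine tendsto_order.2 ⟨fun r hr => ?_, fun r hr => ?_⟩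
  · have hc : ContinuousAt (fun x => (1 - x / b) * g 0 + x / b * g b) 0 := by fun_prop
    have : ∀ᶠ x in 𝓝 (0:ℝ), r < (1 - x / b) * g 0 + x / b * g b :=
      hc.eventually_const_lt (by simpa using hr)
    filter_upwards [this.filter_mono nhdsWithin_le_nhds, self_mem_nhdsWithin] with x h1 hx
    exact h1.trans_le (hlower x hx)
  · obtain ⟨_, ⟨t, ht, rfl⟩, hlt⟩ := exists_lt_of_csInf_lt (hT.image _) hr
    have hc : ContinuousAt (fun x => α t + x * β t) 0 := by fun_prop
    have : ∀ᶠ x in 𝓝 (0:ℝ), α t + x * β t < r := hc.eventually_lt_const hlt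
    filter_upwards [this.filter_mono nhdsWithin_le_nhds, self_mem_nhdsWithin] with x h1 hx
    exact (hle x hx t ht).trans_lt h1

lemma continuousWithinAt_sInf_affine_right (hT : T.Nonempty) (h0 : BddBelow (α '' T))
    (hb : BddBelow ((fun t => α t + b * β t) '' T)) (hb0 : 0 < b) :
    ContinuousWithinAt (fun x => sInf ((fun t => α t + x * β t) '' T)) (Icc 0 b) b := by
  have h := continuousWithinAt_sInf_affine_left (α := fun t => α t + b * β t) (β := fun t => -β t)
    hT hb (b := b) (by simpa [add_assoc] using h0) hb0
  have hc : ContinuousWithinAt (fun x => b - x) (Icc 0 b) b := by fun_prop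
  have hmaps : MapsTo (fun x => b - x) (Icc 0 b) (Icc 0 b) := fun x hx =>
    ⟨by linarith [hx.2], by linarith [hx.1]⟩
  have h' : ContinuousWithinAt (fun x => sInf ((fun t => (α t + b * β t) + x * -β t) '' T))
    (Icc 0 b) (b - b) := by rwa [sub_self]
  refine (h'.comp hc hmaps).congr (fun x _ => ?_) ?_
  all_goals
    simp only [Function.comp]
    congr 2
    ext t
    ring

end AffineInfimum

/-! ### Minimisation of the potential. -/

section Potential

variable {Q t x b : ℝ} {n : ℕ}

lemma potential_eq_affine :
    potential Q n x t = potential Q n 0 t + x * ((n + 2) * logOdds Q t) := by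
  unfold potential logOdds
  ring

lemma potential_continuousOn (hQ : 1 ≤ Q) : ContinuousOn (potential Q n x) (Ioo (-Q⁻¹) 1) :=
  fun _ ht => (hasDerivAt_potential hQ ht).continuousAt.continuousWithinAt

lemma potential_factor_pos (hQ : 1 ≤ Q) (ht : t ∈ Ioo (-Q⁻¹) 1) :
    0 < (n + 2) * (Q + 1) / ((1 - t) * (1 + Q * t)) :=
  div_pos (by positivity) (mul_pos (sub_pos.2 ht.2) (one_add_mul_pos_of_mem hQ ht))

lemma potential_critPoint_le (hQ : 1 ≤ Q) (hn : 1 ≤ n) {s : ℝ} (hs : s ∈ Ioo (-Q⁻¹) 1)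
    (ht : t ∈ Ioo (-Q⁻¹) 1) :
    potential Q n (critPoint Q n s) s ≤ potential Q n (critPoint Q n s) t := by
  have hanti := critPoint_strictAntiOn hQ hn
  rcases le_total s t with h | h
  · have hsub : Icc s t ⊆ Ioo (-Q⁻¹) 1 := fun r hr => ⟨hs.1.trans_le hr.1, hr.2.trans_lt ht.2⟩
    have : MonotoneOn (potential Q n (critPoint Q n s)) (Icc s t) := by
      refine monotoneOn_of_deriv_nonneg (convex_Icc s t) ((potential_continuousOn hQ).mono hsub)
        (fun r hr => (hasDerivAt_potential hQ
          (hsub (interior_subset hr))).differentiableAt.differentiableWithinAt) fun r hr => ?_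
      have hr' := hsub (interior_subset hr)
      rw [(hasDerivAt_potential hQ hr').deriv]
      exact mul_nonneg (potential_factor_pos hQ hr').le
        (sub_nonneg.2 (hanti.antitoneOn hs hr' (interior_subset hr).1))
    exact this (left_mem_Icc.2 h) (right_mem_Icc.2 h) h
  · have hsub : Icc t s ⊆ Ioo (-Q⁻¹) 1 := fun r hr => ⟨ht.1.trans_le hr.1, hr.2.trans_lt hs.2⟩
    have : AntitoneOn (potential Q n (critPoint Q n s)) (Icc t s) := by
      refine antitoneOn_of_deriv_nonpos (convex_Icc t s) ((potential_continuousOn hQ).mono hsub)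
        (fun r hr => (hasDerivAt_potential hQ
          (hsub (interior_subset hr))).differentiableAt.differentiableWithinAt) fun r hr => ?_
      have hr' := hsub (interior_subset hr)
      rw [(hasDerivAt_potential hQ hr').deriv]
      exact mul_nonpos_of_nonneg_of_nonpos (potential_factor_pos hQ hr').le
        (sub_nonpos.2 (hanti.antitoneOn hr' hs (interior_subset hr).2))
    exact this (left_mem_Icc.2 h) (right_mem_Icc.2 h) h

lemma minPotential_critPoint (hQ : 1 ≤ Q) (hn : 1 ≤ n) (ht : t ∈ Ioo (-Q⁻¹) 1) :
    minPotential Q n (critPoint Q n t) = potential Q n (critPoint Q n t) t := by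
  refine IsLeast.csInf_eq ⟨mem_image_of_mem _ ht, ?_⟩
  rintro _ ⟨s, hs, rfl⟩
  exact potential_critPoint_le hQ hn ht hs

/-- At `x = 0` the potential is decreasing, because `critPoint` is positive; the term `ln (1 - t)`
drops out, so the infimum is the boundary value at `t = 1`. -/
lemma isGLB_potential_zero (hQ : 1 ≤ Q) :
    IsGLB (potential Q n 0 '' Ioo (-Q⁻¹) 1) (-(n + 1) * Real.log (1 + Q)) := by
  have hne : -Q⁻¹ < 1 := (zero_mem_Ioo_neg_inv hQ).1.trans one_pos
  have hform : potential Q n 0 =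
      fun t => Real.log (1 + Q * t ^ (n + 2)) - (n + 2) * Real.log (1 + Q * t) := by
    ext t; unfold potential; ring
  have h1 : potential Q n 0 1 = -(n + 1) * Real.log (1 + Q) := by
    rw [hform]; simp; ring
  have hc1 : ContinuousAt (potential Q n 0) 1 := by
    rw [hform]
    have h1 : 1 + Q * 1 ^ (n + 2) ≠ 0 := by rw [one_pow]; linarith
    have h2 : 1 + Q * 1 ≠ 0 := by linarith
    fun_prop (disch := assumption)
  have hcont : ContinuousOn (potential Q n 0) (Ioc (-Q⁻¹) 1) := by
    intro t ht
    rcases ht.2.eq_or_lt with rfl | h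
    · exact hc1.continuousWithinAt
    · exact (hasDerivAt_potential hQ ⟨ht.1, h⟩).continuousAt.continuousWithinAt
  have hanti : AntitoneOn (potential Q n 0) (Ioc (-Q⁻¹) 1) := by
    refine antitoneOn_of_deriv_nonpos (convex_Ioc _ _) hcont ?_ ?_ <;> rw [interior_Ioc]
    · exact fun r hr => (hasDerivAt_potential hQ hr).differentiableAt.differentiableWithinAt
    · intro r hr
      rw [(hasDerivAt_potential hQ hr).deriv]
      exact mul_nonpos_of_nonneg_of_nonpos (potential_factor_pos hQ hr).le
        (by linarith [(critPoint_mem_Ioo (n := n) hQ hr).1])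
  rw [← h1]
  constructor
  · rintro _ ⟨t, ht, rfl⟩
    exact hanti ⟨ht.1, ht.2.le⟩ ⟨hne, le_rfl⟩ ht.2.le
  · intro v hv
    refine ge_of_tendsto (hc1.tendsto.mono_left (nhdsWithin_le_nhds (s := Iio 1))) ?_
    filter_upwards [Ioo_mem_nhdsLT hne] with t ht using hv (mem_image_of_mem _ ht)

lemma minPotential_zero (hQ : 1 ≤ Q) : minPotential Q n 0 = -(n + 1) * Real.log (1 + Q) :=
  (isGLB_potential_zero hQ).csInf_eq ((nonempty_Ioo.2
    ((zero_mem_Ioo_neg_inv hQ).1.trans one_pos)).image _)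

lemma half_mul_le_one_add_pow (hodd : Odd n) (ht : t ∈ Ioo (-1 : ℝ) 1) :
    1 / 2 * (1 + t) ≤ 1 + t ^ (n + 2) := by
  have hodd2 : Odd (n + 2) := by obtain ⟨k, rfl⟩ := hodd; exact ⟨k + 1, by ring⟩
  rcases le_or_gt 0 t with h | h
  · have : 0 ≤ t ^ (n + 2) := by positivity
    linarith [ht.2]
  · have := neg_le_pow_succ (t := t) (abs_le.2 ⟨ht.1.le, ht.2.le⟩) (n + 1)
    rw [abs_of_neg h] at this
    have h2 : t ^ (n + 1 + 1) = t ^ (n + 2) := rfl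
    linarith [ht.1]

lemma half_le_one_add_mul_pow (hQ : 2 ≤ Q ∨ Even n) (hQ1 : 1 ≤ Q) (ht : t ∈ Ioo (-Q⁻¹) 1) :
    1 / 2 ≤ 1 + Q * t ^ (n + 2) := by
  have hQ0 : 0 < Q := by linarith
  have habs := abs_lt_one_of_mem hQ1 ht
  rcases le_or_gt 0 (t ^ (n + 2)) with h | h
  · have : 0 ≤ Q * t ^ (n + 2) := by positivity
    linarith
  · have ht0 : t < 0 := by
      by_contra hcon
      exact absurd h (not_lt.2 (pow_nonneg (not_lt.1 hcon) _))
    have hQ2 : 2 ≤ Q := by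
      refine hQ.resolve_right fun hev => ?_
      have : Even (n + 2) := by obtain ⟨k, rfl⟩ := hev; exact ⟨k + 1, by ring⟩
      exact absurd h (not_lt.2 (this.pow_nonneg t))
    have h1 := one_add_mul_pos_of_mem hQ1 ht
    have h2 : -(1 / 2) ≤ t := by nlinarith
    have h3 : |t ^ (n + 1)| ≤ 1 / 2 := by
      rw [abs_pow, abs_of_neg ht0]
      exact (pow_le_of_le_one (by linarith) (by linarith) (by omega)).trans (by linarith)
    have h4 := abs_le.1 h3
    rw [show t ^ (n + 2) = t ^ (n + 1) * t by ring] at h ⊢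
    have h5 : 0 < t ^ (n + 1) := pos_of_mul_neg_left h ht0.le
    nlinarith [mul_pos h5 h1]

/-- The danger is at `t = -Q⁻¹`. In the generic case `x = 1` removes the term `ln (1 + Q t)` and the
remaining logarithm is at least `ln (1/2)`. In the exceptional case `b` gives `ln (1 + t)` the
coefficient `-1`, exactly what `ln (1 + t ^ (n + 2))` can compensate. -/
lemma bddBelow_potential_right (hQ : 1 ≤ Q)
    (hb : b = if Q = 1 ∧ Odd n then 1 - 1 / ((n : ℝ) + 2) else 1) (hQ2 : Q = 1 ∨ 2 ≤ Q) :
    BddBelow (potential Q n b '' Ioo (-Q⁻¹) 1) := by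
  have hlog : ∀ t ∈ Ioo (-Q⁻¹) 1, Real.log (1 - t) ≤ Real.log 2 := fun t ht =>
    Real.log_le_log (by linarith [ht.2]) (by linarith [(abs_lt.1 (abs_lt_one_of_mem hQ ht)).1])
  have hlog2 : 0 < Real.log 2 := Real.log_pos one_lt_two
  refine ⟨Real.log (1 / 2) - (n + 2) * Real.log 2, ?_⟩
  rintro _ ⟨t, ht, rfl⟩
  have ht2 := hlog t ht
  by_cases hsp : Q = 1 ∧ Odd n
  · obtain ⟨rfl, hodd⟩ := hsp
    rw [if_pos ⟨rfl, hodd⟩] at hb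
    have ht' : t ∈ Ioo (-1 : ℝ) 1 := by simpa using ht
    have h1 : 0 < 1 + t := by linarith [ht'.1]
    have h2 := Real.log_le_log (by positivity) (half_mul_le_one_add_pow hodd ht')
    rw [Real.log_mul (by norm_num) h1.ne'] at h2
    have hb1 : ((n : ℝ) + 2) * b = n + 1 := by rw [hb]; field_simp; ring
    have hb2 : ((n : ℝ) + 2) * (1 - b) = 1 := by rw [mul_sub, hb1]; ring
    unfold potential
    rw [hb1, hb2]
    simp only [one_mul]
    have := mul_le_mul_of_nonneg_left ht2 (by positivity : 0 ≤ (n : ℝ) + 1)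
    linarith
  · rw [if_neg hsp] at hb
    have hcase : 2 ≤ Q ∨ Even n := by
      rcases hQ2 with h | h
      · exact Or.inr (Nat.not_odd_iff_even.1 fun ho => hsp ⟨h, ho⟩)
      · exact Or.inl h
    have h2 := Real.log_le_log (by norm_num) (half_le_one_add_mul_pow hcase hQ ht)
    unfold potential
    rw [hb]
    have := mul_le_mul_of_nonneg_left ht2 (by positivity : 0 ≤ (n : ℝ) + 2)
    linarith

/-- Real `sInf` is meaningful only for sets bounded below. Bounds at the endpoints `0` and `b`
suffice, since the potential is affine in `x`. -/
lemma isGLB_potential (hQ : 1 ≤ Q)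
    (hb : b = if Q = 1 ∧ Odd n then 1 - 1 / ((n : ℝ) + 2) else 1) (hQ2 : Q = 1 ∨ 2 ≤ Q)
    (hb0 : 0 < b) (hx : x ∈ Icc 0 b) :
    IsGLB (potential Q n x '' Ioo (-Q⁻¹) 1) (minPotential Q n x) := by
  refine isGLB_csInf ((nonempty_Ioo.2 ((zero_mem_Ioo_neg_inv hQ).1.trans one_pos)).image _) ?_
  have h1 := bddBelow_potential_right hQ hb hQ2
  have h0 : BddBelow (potential Q n 0 '' Ioo (-Q⁻¹) 1) := ⟨_, (isGLB_potential_zero hQ).1⟩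
  simp_rw [potential_eq_affine (x := b)] at h1
  have := bddBelow_affine_image h0 h1 hb0 hx
  simp_rw [← potential_eq_affine] at this
  exact this

lemma continuousWithinAt_minPotential (hQ : 1 ≤ Q)
    (hb : b = if Q = 1 ∧ Odd n then 1 - 1 / ((n : ℝ) + 2) else 1) (hQ2 : Q = 1 ∨ 2 ≤ Q)
    (hb0 : 0 < b) :
    ContinuousWithinAt (minPotential Q n) (Icc 0 b) 0 ∧
      ContinuousWithinAt (minPotential Q n) (Icc 0 b) b := by
  have hT : (Ioo (-Q⁻¹) 1).Nonempty := nonempty_Ioo.2 ((zero_mem_Ioo_neg_inv hQ).1.trans one_pos)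
  have h1 := bddBelow_potential_right hQ hb hQ2
  have h0 : BddBelow (potential Q n 0 '' Ioo (-Q⁻¹) 1) := ⟨_, (isGLB_potential_zero hQ).1⟩
  simp_rw [potential_eq_affine (x := b)] at h1
  have hl := continuousWithinAt_sInf_affine_left hT h0 h1 hb0
  have hr := continuousWithinAt_sInf_affine_right hT h0 h1 hb0
  simp_rw [← potential_eq_affine] at hl hr
  exact ⟨hl, hr⟩

end Potential

/-! ### The minimiser as a differentiable function of `x`. -/

/-- The parameter `t` with `critPoint Q n t = x`. -/
noncomputable def critParam (Q : ℝ) (n : ℕ) : ℝ → ℝ :=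
  Function.invFunOn (critPoint Q n) (Ioo (-Q⁻¹) 1)

section CritParam

variable {Q t x b : ℝ} {n : ℕ}

lemma critParam_mem (himg : critPoint Q n '' Ioo (-Q⁻¹) 1 = Ioo 0 b) (hx : x ∈ Ioo 0 b) :
    critParam Q n x ∈ Ioo (-Q⁻¹) 1 :=
  Function.invFunOn_mem (by rw [← himg] at hx; exact hx)

lemma critPoint_critParam (himg : critPoint Q n '' Ioo (-Q⁻¹) 1 = Ioo 0 b) (hx : x ∈ Ioo 0 b) :
    critPoint Q n (critParam Q n x) = x :=
  Function.invFunOn_eq (by rw [← himg] at hx; exact hx)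

lemma critParam_critPoint (hQ : 1 ≤ Q) (hn : 1 ≤ n) (ht : t ∈ Ioo (-Q⁻¹) 1) :
    critParam Q n (critPoint Q n t) = t :=
  (critPoint_strictAntiOn hQ hn).injOn (Function.invFunOn_mem ⟨t, ht, rfl⟩) ht
    (Function.invFunOn_eq ⟨t, ht, rfl⟩)

lemma critParam_strictAntiOn (hQ : 1 ≤ Q) (hn : 1 ≤ n)
    (himg : critPoint Q n '' Ioo (-Q⁻¹) 1 = Ioo 0 b) :
    StrictAntiOn (critParam Q n) (Ioo 0 b) := by
  intro x hx y hy hxy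
  refine ((critPoint_strictAntiOn hQ hn).lt_iff_gt (critParam_mem himg hx)
    (critParam_mem himg hy)).1 ?_
  rwa [critPoint_critParam himg hx, critPoint_critParam himg hy]

lemma continuousAt_critParam (hQ : 1 ≤ Q) (hn : 1 ≤ n)
    (himg : critPoint Q n '' Ioo (-Q⁻¹) 1 = Ioo 0 b) (hx : x ∈ Ioo 0 b) :
    ContinuousAt (critParam Q n) x := by
  have hmono : StrictMonoOn (fun x => -critParam Q n x) (Ioo 0 b) :=
    (critParam_strictAntiOn hQ hn himg).neg
  have hopen : Ioo (-1) (Q⁻¹) ⊆ (fun x => -critParam Q n x) '' Ioo 0 b := by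
    intro s hs
    have hs' : -s ∈ Ioo (-Q⁻¹) 1 := ⟨by linarith [hs.2], by linarith [hs.1]⟩
    refine ⟨critPoint Q n (-s), himg ▸ mem_image_of_mem _ hs', ?_⟩
    simp only
    rw [critParam_critPoint hQ hn hs', neg_neg]
  have hmem := critParam_mem himg hx
  -- A strictly monotone function whose image contains a neighbourhood of its value is continuous
  -- there; the negation only turns decreasing into increasing.
  have := hmono.continuousAt_of_image_mem_nhds (isOpen_Ioo.mem_nhds hx)
    (mem_of_superset (isOpen_Ioo.mem_nhds ⟨by linarith [hmem.2], by linarith [hmem.1]⟩) hopen)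
  exact this.neg.congr (Eventually.of_forall fun y => neg_neg _)

lemma hasDerivAt_critParam (hQ : 1 ≤ Q) (hn : 1 ≤ n)
    (himg : critPoint Q n '' Ioo (-Q⁻¹) 1 = Ioo 0 b) (hx : x ∈ Ioo 0 b) :
    ∃ v ≠ 0, HasDerivAt (critPoint Q n) v (critParam Q n x) ∧
      HasDerivAt (critParam Q n) v⁻¹ x := by
  obtain ⟨v, hv, hd⟩ := hasDerivAt_critPoint hQ hn (critParam_mem himg hx)
  refine ⟨v, hv.ne, hd, hd.of_local_left_inverse (continuousAt_critParam hQ hn himg hx) hv.ne ?_⟩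
  filter_upwards [isOpen_Ioo.mem_nhds hx] with y hy using critPoint_critParam himg hy

end CritParam

/-! ### The real growth rate, its derivative and special values. -/

/-- The growth rate as a real function, for `d = n + 2`. -/
noncomputable def growthRate (q n : ℕ) (c x : ℝ) : ℝ :=
  (1 - c) * Real.qaryEntropy q x +
    c / (n + 2) * ((n + 1) * Real.log q + minPotential ((q : ℝ) - 1) n x)

section GrowthRate

variable {q n : ℕ} {b c x y : ℝ}

/-- A real number strictly between the two values would be a lower bound exceeding the greatest one.
-/
lemma iInf_coe_eq_of_isGLB {s : Set ℝ} {f : ℝ → ℝ} {v : ℝ} (h : IsGLB (f '' s) v) :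
    ⨅ y ∈ s, (f y : EReal) = v := by
  refine le_antisymm ?_ (le_iInf₂ fun y hy => EReal.coe_le_coe_iff.2 (h.1 (mem_image_of_mem _ hy)))
  by_contra hcon
  obtain ⟨r, hr1, hr2⟩ := EReal.lt_iff_exists_real_btwn.1 (not_le.1 hcon)
  refine absurd (EReal.coe_lt_coe_iff.1 hr1) (not_lt.2 (h.2 ?_))
  rintro _ ⟨y, hy, rfl⟩
  exact EReal.coe_le_coe_iff.1 (hr2.le.trans (iInf₂_le y hy))

lemma one_le_natCast_sub_one (hq : 2 ≤ q) : 1 ≤ (q : ℝ) - 1 := by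
  have : (2 : ℝ) ≤ q := by exact_mod_cast hq
  linarith

lemma infoDivergence_eq (hx : x ∈ Icc (0 : ℝ) 1) (hy : y ∈ Ioo (0 : ℝ) 1) :
    infoDivergence x y =
      -Real.binEntropy x - x * Real.log y - (1 - x) * Real.log (1 - y) := by
  have hmul : ∀ {a b : ℝ}, 0 ≤ a → 0 < b →
      a * Real.log (a / b) = a * Real.log a - a * Real.log b := by
    intro a b ha hb
    rcases ha.eq_or_lt with rfl | ha
    · simp
    · rw [Real.log_div ha.ne' hb.ne']; ring
  unfold infoDivergence Real.binEntropy
  rw [hmul hx.1 hy.1, hmul (by linarith [hx.2]) (by linarith [hy.2]), Real.log_inv, Real.log_inv]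
  ring

lemma deltaTwo_eq (hq : 2 ≤ q) (hx : x ∈ Icc (0 : ℝ) 1) (hy : y ∈ Ioo (0 : ℝ) 1) :
    deltaTwo q (n + 2) x y = -((n : ℝ) + 2) * Real.qaryEntropy q x + (n + 2) * Real.log q +
      potential ((q : ℝ) - 1) n x (1 - (q : ℝ) * y / ((q : ℝ) - 1)) := by
  have hQ := one_le_natCast_sub_one hq
  have hq0 : (0 : ℝ) < q := by linarith
  have hQ0 : (0 : ℝ) < (q : ℝ) - 1 := by linarith
  have hy1 : 0 < 1 - y := by linarith [hy.2]
  have h1 : 1 - (1 - (q : ℝ) * y / ((q : ℝ) - 1)) = q * y / ((q : ℝ) - 1) := by ring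
  have h2 : 1 + ((q : ℝ) - 1) * (1 - (q : ℝ) * y / ((q : ℝ) - 1)) = q * (1 - y) := by
    field_simp; ring
  unfold deltaTwo rhoLDPC potential Real.qaryEntropy
  rw [infoDivergence_eq hx hy, h1, h2, Real.log_div (mul_pos hq0 hy.1).ne' hQ0.ne',
    Real.log_mul hq0.ne' hy.1.ne', Real.log_mul hq0.ne' hy1.ne']
  push_cast
  ring

lemma deltaTwo_image (hq : 2 ≤ q) (hx : x ∈ Icc (0 : ℝ) 1) :
    deltaTwo q (n + 2) x '' Ioo 0 1 =
      (fun w => -((n : ℝ) + 2) * Real.qaryEntropy q x + (n + 2) * Real.log q + w) ''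
        (potential ((q : ℝ) - 1) n x '' Ioo (-((q : ℝ) - 1)⁻¹) 1) := by
  have hQ := one_le_natCast_sub_one hq
  have hq0 : (0 : ℝ) < q := by linarith
  have hQ0 : (0 : ℝ) < (q : ℝ) - 1 := by linarith
  apply Subset.antisymm
  · rintro _ ⟨y, hy, rfl⟩
    rw [deltaTwo_eq hq hx hy]
    refine mem_image_of_mem _ (mem_image_of_mem _ (mem_Ioo_of_one_add_mul_pos hQ ?_ ?_))
    · have : 1 + ((q : ℝ) - 1) * (1 - (q : ℝ) * y / ((q : ℝ) - 1)) = q * (1 - y) := by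
        field_simp; ring
      rw [this]
      exact mul_pos hq0 (by linarith [hy.2])
    · have : 0 < (q : ℝ) * y / ((q : ℝ) - 1) := div_pos (mul_pos hq0 hy.1) hQ0
      linarith
  · rintro _ ⟨_, ⟨t, ht, rfl⟩, rfl⟩
    have h1 := one_add_mul_pos_of_mem hQ ht
    have hy : ((q : ℝ) - 1) * (1 - t) / q ∈ Ioo (0 : ℝ) 1 := by
      refine ⟨div_pos (mul_pos hQ0 (by linarith [ht.2])) hq0, ?_⟩
      rw [div_lt_one hq0]
      linarith
    refine ⟨_, hy, ?_⟩
    rw [deltaTwo_eq hq hx hy]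
    simp only
    congr 2
    field_simp
    ring

lemma omegaLDPC_eq (hq : 2 ≤ q) (hx : x ∈ Icc (0 : ℝ) 1) (k : ℕ)
    (h : IsGLB (potential ((q : ℝ) - 1) n x '' Ioo (-((q : ℝ) - 1)⁻¹) 1)
      (minPotential ((q : ℝ) - 1) n x)) :
    omegaLDPC q k (n + 2) x = (growthRate q n k x : EReal) := by
  have hg : IsGLB (deltaTwo q (n + 2) x '' Ioo 0 1) (-((n : ℝ) + 2) * Real.qaryEntropy q x +
      (n + 2) * Real.log q + minPotential ((q : ℝ) - 1) n x) := by
    rw [deltaTwo_image hq hx]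
    exact (OrderIso.addLeft _).isGLB_image'.2 h
  unfold omegaLDPC deltaLDPC
  rw [iInf_coe_eq_of_isGLB hg, ← EReal.coe_sub, ← EReal.coe_mul, ← EReal.coe_add,
    EReal.coe_eq_coe_iff]
  unfold growthRate
  push_cast
  field_simp
  ring

lemma hasDerivAt_growthRate (hq : 2 ≤ q) (hn : 1 ≤ n)
    (himg : critPoint ((q : ℝ) - 1) n '' Ioo (-((q : ℝ) - 1)⁻¹) 1 = Ioo 0 b)
    (hx : x ∈ Ioo 0 b) :
    HasDerivAt (growthRate q n c)
      (growthSlope ((q : ℝ) - 1) n (c - 1) (critParam ((q : ℝ) - 1) n x)) x := by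
  have hQ := one_le_natCast_sub_one hq
  set Q := (q : ℝ) - 1 with hQdef
  have ht := critParam_mem himg hx
  have hXx := critPoint_critParam himg hx
  obtain ⟨v, hv0, hX, hτ⟩ := hasDerivAt_critParam hQ hn himg hx
  set t := critParam Q n x with ht_def
  have hX01 := critPoint_mem_Ioo (n := n) hQ ht
  have hH := HasDerivAt.comp (h₂ := Real.qaryEntropy q) t
    (Real.hasDerivAt_qaryEntropy hX01.1.ne' hX01.2.ne) hX
  rw [← hQdef, log_odds_critPoint hQ ht] at hH
  -- The envelope step: along the curve of minimisers the partial derivative in `t` vanishes, and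
  -- only the motion of `x` contributes.
  have hW : HasDerivAt (fun t => potential Q n (critPoint Q n t) t)
      ((n + 2) * logOdds Q t * v) t := by
    have hL := hasDerivAt_logOdds (one_add_mul_pos_of_mem hQ ht) ht.2
    have := (hasDerivAt_potential (n := n) (x := 0) hQ ht).add
      (hX.mul (hL.const_mul ((n : ℝ) + 2)))
    have hfun : (fun t => potential Q n (critPoint Q n t) t) =
        fun t => potential Q n 0 t + critPoint Q n t * ((n + 2) * logOdds Q t) :=
      funext fun t => potential_eq_affine
    rw [hfun]
    refine this.congr_deriv ?_
    have h1 := (one_add_mul_pos_of_mem hQ ht).ne'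
    have h2 : 1 - t ≠ 0 := by linarith [ht.2]
    field_simp
    ring
  have hΩ := ((hH.const_mul (1 - c)).add
    (((hW.const_add ((n + 1) * Real.log q)).const_mul (c / ((n : ℝ) + 2)))))
  have hcomp := hΩ.comp x hτ
  have hev : growthRate q n c =ᶠ[𝓝 x] fun y =>
      (1 - c) * Real.qaryEntropy q (critPoint Q n (critParam Q n y)) +
      c / (n + 2) * ((n + 1) * Real.log q +
        potential Q n (critPoint Q n (critParam Q n y)) (critParam Q n y)) := by
    filter_upwards [isOpen_Ioo.mem_nhds hx] with y hy
    have hmy := critParam_mem himg hy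
    unfold growthRate
    rw [← minPotential_critPoint hQ hn hmy, critPoint_critParam himg hy]
  refine HasDerivAt.congr_of_eventuallyEq ?_ hev
  refine HasDerivAt.congr_deriv hcomp ?_
  unfold growthSlope
  have : (n : ℝ) + 2 ≠ 0 := by positivity
  field_simp
  ring

lemma continuousOn_growthRate (hq : 2 ≤ q) (hn : 1 ≤ n)
    (hb : b = if (q : ℝ) - 1 = 1 ∧ Odd n then 1 - 1 / ((n : ℝ) + 2) else 1)
    (hQ2 : (q : ℝ) - 1 = 1 ∨ 2 ≤ (q : ℝ) - 1) (hb0 : 0 < b) :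
    ContinuousOn (growthRate q n c) (Icc 0 b) := by
  have hQ := one_le_natCast_sub_one hq
  obtain ⟨hl, hr⟩ := continuousWithinAt_minPotential hQ hb hQ2 hb0
  have hend : ∀ {x}, ContinuousWithinAt (minPotential ((q : ℝ) - 1) n) (Icc 0 b) x →
      ContinuousWithinAt (growthRate q n c) (Icc 0 b) x := fun h =>
    (Real.qaryEntropy_continuous.continuousWithinAt.const_mul _).add
      ((h.const_add _).const_mul _)
  intro x hx
  rcases hx.1.eq_or_lt with rfl | h0
  · exact hend hl
  · rcases hx.2.eq_or_lt with rfl | h1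
    · exact hend hr
    · exact (hasDerivAt_growthRate hq hn (critPoint_image hQ hb hQ2 hn)
        ⟨h0, h1⟩).continuousAt.continuousWithinAt

lemma growthRate_zero (hq : 2 ≤ q) : growthRate q n c 0 = 0 := by
  unfold growthRate
  rw [minPotential_zero (one_le_natCast_sub_one hq), Real.qaryEntropy_zero, add_sub_cancel]
  ring

/-- This point corresponds to the parameter `t = 0`, where the potential vanishes and `H_q = ln q`.
Nonnegativity of the value is the condition `c ≤ d`. -/
lemma growthRate_one_sub_inv (hq : 2 ≤ q) (hn : 1 ≤ n) :
    growthRate q n c (1 - 1 / (q : ℝ)) = (1 - c / (n + 2)) * Real.log q := by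
  have hQ := one_le_natCast_sub_one hq
  have hq0 : (0 : ℝ) < q := by linarith
  have h1 : critPoint ((q : ℝ) - 1) n 0 = 1 - 1 / (q : ℝ) := by
    rw [critPoint_zero]; field_simp; ring
  have h2 := minPotential_critPoint (n := n) hQ hn (zero_mem_Ioo_neg_inv hQ)
  rw [h1] at h2
  have h3 : Real.qaryEntropy q (1 - 1 / (q : ℝ)) = Real.log q := by
    unfold Real.qaryEntropy Real.binEntropy
    have h4 : 1 - 1 / (q : ℝ) = ((q : ℝ) - 1) / q := by field_simp
    have h5 : 1 - ((q : ℝ) - 1) / q = 1 / q := by field_simp; ring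
    push_cast
    rw [h4, h5, Real.log_inv, Real.log_inv, Real.log_div (by linarith) hq0.ne', one_div,
      Real.log_inv]
    field_simp
    ring
  unfold growthRate
  rw [h2, h3]
  simp [potential]
  have : (n : ℝ) + 2 ≠ 0 := by positivity
  field_simp
  ring

lemma omegaReal_one_sub (k : ℕ) {d : ℕ} (hd : Even d) :
    omegaReal 2 k d (1 - x) = omegaReal 2 k d x := by
  have hsymm : ∀ y, deltaTwo 2 d (1 - x) (1 - y) = deltaTwo 2 d x y := by
    intro y
    have h1 : (1 - 2 * (1 - y) / (2 - 1) : ℝ) ^ d = (1 - 2 * y / (2 - 1)) ^ d := by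
      rw [← hd.neg_pow]; congr 1; ring
    unfold deltaTwo infoDivergence rhoLDPC
    push_cast
    rw [h1, sub_sub_cancel, sub_sub_cancel]
    ring
  have hδ : deltaLDPC 2 d (1 - x) = deltaLDPC 2 d x := by
    unfold deltaLDPC
    have hmem : ∀ {y : ℝ}, y ∈ Ioo (0 : ℝ) 1 → 1 - y ∈ Ioo (0 : ℝ) 1 := fun hy =>
      ⟨by linarith [hy.2], by linarith [hy.1]⟩
    refine le_antisymm (le_iInf₂ fun y hy => ?_) (le_iInf₂ fun y hy => ?_)
    · rw [← hsymm]
      exact iInf₂_le (f := fun y _ => (deltaTwo 2 d (1 - x) y : EReal)) _ (hmem hy)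
    · rw [← sub_sub_cancel 1 y, hsymm]
      exact iInf₂_le (f := fun y _ => (deltaTwo 2 d x y : EReal)) _ (hmem hy)
  unfold omegaReal omegaLDPC
  rw [hδ, Real.qaryEntropy_two, Real.binEntropy_one_sub]

end GrowthRate

/-! ### From derivatives to shape. -/

section MonotonicityTransfer

variable {f K τ : ℝ → ℝ} {b u v : ℝ} {S : Set ℝ}

lemma convexOn_of_hasDerivAt_comp (hf : ∀ x ∈ Ioo u v, HasDerivAt f (K (τ x)) x)
    (hτ : AntitoneOn τ (Ioo u v)) (hm : MapsTo τ (Ioo u v) S) (hK : AntitoneOn K S) :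
    ConvexOn ℝ (Ioo u v) f := by
  refine MonotoneOn.convexOn_of_deriv (convex_Ioo u v)
    (fun x hx => (hf x hx).continuousAt.continuousWithinAt) ?_ ?_ <;> rw [interior_Ioo]
  · exact fun x hx => (hf x hx).differentiableAt.differentiableWithinAt
  · intro x hx y hy hxy
    rw [(hf x hx).deriv, (hf y hy).deriv]
    exact hK (hm hy) (hm hx) (hτ hx hy hxy)

lemma concaveOn_of_hasDerivAt_comp (hf : ∀ x ∈ Ioo u v, HasDerivAt f (K (τ x)) x)
    (hτ : AntitoneOn τ (Ioo u v)) (hm : MapsTo τ (Ioo u v) S) (hK : MonotoneOn K S) :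
    ConcaveOn ℝ (Ioo u v) f := by
  refine AntitoneOn.concaveOn_of_deriv (convex_Ioo u v)
    (fun x hx => (hf x hx).continuousAt.continuousWithinAt) ?_ ?_ <;> rw [interior_Ioo]
  · exact fun x hx => (hf x hx).differentiableAt.differentiableWithinAt
  · intro x hx y hy hxy
    rw [(hf x hx).deriv, (hf y hy).deriv]
    exact hK (hm hy) (hm hx) (hτ hx hy hxy)

/-- A function that decreases from `0` and then increases to a nonnegative value has exactly one
zero past its starting point. -/
lemma exists_unique_zero_of_valley {p : ℝ} (hu : 0 < u) (hup : u < p) (hf0 : f 0 = 0)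
    (hfp : 0 ≤ f p) (hcont : ContinuousOn f (Icc 0 p)) (hanti : StrictAntiOn f (Icc 0 u))
    (hmono : StrictMonoOn f (Icc u p)) :
    ∃ x₀ ∈ Ioc u p, f x₀ = 0 ∧ (∀ x ∈ Ioc 0 p, f x = 0 → x = x₀) ∧
      (∀ x ∈ Ioo 0 x₀, f x < 0) ∧ ∀ x ∈ Ioo x₀ p, 0 < f x := by
  have hneg : ∀ x ∈ Ioc 0 u, f x < 0 := fun x hx =>
    hf0 ▸ hanti ⟨le_rfl, hu.le⟩ ⟨hx.1.le, hx.2⟩ hx.1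
  have hfu := hneg u ⟨hu, le_rfl⟩
  obtain ⟨x₀, hx₀, hzero⟩ : (0:ℝ) ∈ f '' Icc u p :=
    intermediate_value_Icc hup.le (hcont.mono (Icc_subset_Icc_left hu.le)) ⟨hfu.le, hfp⟩
  have hux : u < x₀ := hx₀.1.lt_of_ne (by rintro rfl; exact hfu.ne hzero)
  refine ⟨x₀, ⟨hux, hx₀.2⟩, hzero, fun x hx h => ?_, fun x hx => ?_, fun x hx => ?_⟩
  · rcases le_or_gt x u with h' | h'
    · exact absurd h (hneg x ⟨hx.1, h'⟩).ne
    · exact hmono.injOn ⟨h'.le, hx.2⟩ hx₀ (h.trans hzero.symm)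
  · rcases le_or_gt x u with h' | h'
    · exact hneg x ⟨hx.1, h'⟩
    · exact hzero ▸ hmono ⟨h'.le, hx.2.le.trans hx₀.2⟩ hx₀ hx.2
  · exact hzero ▸ hmono hx₀ ⟨hx₀.1.trans hx.1.le, hx.2.le⟩ hx.1

lemma strictMonoOn_Icc_of_hasDerivAt (hc : ContinuousOn f (Icc 0 b)) (hu : 0 ≤ u) (hv : v ≤ b)
    (hf : ∀ x ∈ Ioo u v, ∃ m > 0, HasDerivAt f m x) : StrictMonoOn f (Icc u v) := by
  refine strictMonoOn_of_deriv_pos (convex_Icc u v) (hc.mono (Icc_subset_Icc hu hv)) ?_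
  rw [interior_Icc]
  intro x hx
  obtain ⟨m, hm, h⟩ := hf x hx
  rwa [h.deriv]

lemma strictAntiOn_Icc_of_hasDerivAt (hc : ContinuousOn f (Icc 0 b)) (hu : 0 ≤ u) (hv : v ≤ b)
    (hf : ∀ x ∈ Ioo u v, ∃ m < 0, HasDerivAt f m x) : StrictAntiOn f (Icc u v) := by
  refine strictAntiOn_of_deriv_neg (convex_Icc u v) (hc.mono (Icc_subset_Icc hu hv)) ?_
  rw [interior_Icc]
  intro x hx
  obtain ⟨m, hm, h⟩ := hf x hx
  rwa [h.deriv]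

end MonotonicityTransfer

/-! ### Signs of the slope. -/

section SlopeSigns

variable {Q t e a x b : ℝ} {n : ℕ}

lemma critParam_lt_iff (hQ : 1 ≤ Q) (hn : 1 ≤ n)
    (himg : critPoint Q n '' Ioo (-Q⁻¹) 1 = Ioo 0 b) (hx : x ∈ Ioo 0 b)
    (ha : a ∈ Ioo (-Q⁻¹) 1) : critParam Q n x < a ↔ critPoint Q n a < x := by
  rw [← (critPoint_strictAntiOn hQ hn).lt_iff_gt ha (critParam_mem himg hx),
    critPoint_critParam himg hx]

lemma lt_critParam_iff (hQ : 1 ≤ Q) (hn : 1 ≤ n)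
    (himg : critPoint Q n '' Ioo (-Q⁻¹) 1 = Ioo 0 b) (hx : x ∈ Ioo 0 b)
    (ha : a ∈ Ioo (-Q⁻¹) 1) : a < critParam Q n x ↔ x < critPoint Q n a := by
  rw [← (critPoint_strictAntiOn hQ hn).lt_iff_gt (critParam_mem himg hx) ha,
    critPoint_critParam himg hx]

lemma logOdds_pos (hQ : 1 ≤ Q) (ht : t ∈ Ioo 0 1) : 0 < logOdds Q t :=
  logOdds_zero (Q := Q) ▸ logOdds_strictMonoOn hQ (zero_mem_Ioo_neg_inv hQ)
    (mem_of_mem_Ico_zero_one hQ ⟨ht.1.le, ht.2⟩) ht.1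

lemma logOdds_neg (hQ : 1 ≤ Q) (ht : t ∈ Ioo (-Q⁻¹) 0) : logOdds Q t < 0 :=
  logOdds_zero (Q := Q) ▸ logOdds_strictMonoOn hQ ⟨ht.1, ht.2.trans one_pos⟩
    (zero_mem_Ioo_neg_inv hQ) ht.2

lemma growthSlope_one_pos (hQ : 1 ≤ Q) (hn : 1 ≤ n) (ht : t ∈ Ioo 0 1) :
    0 < growthSlope Q n 1 t := by
  have hT := mem_of_mem_Ico_zero_one hQ ⟨ht.1.le, ht.2⟩
  have := logOdds_strictMonoOn hQ (pow_succ_mem hQ hT n) hT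
    (pow_lt_self_of_lt_one₀ ht.1 ht.2 (by omega))
  unfold growthSlope
  linarith

lemma growthSlope_one_neg (hQ : 1 ≤ Q) (hn : 1 ≤ n) (ht : t ∈ Ioo (-Q⁻¹) 0) :
    growthSlope Q n 1 t < 0 := by
  have hT : t ∈ Ioo (-Q⁻¹) 1 := ⟨ht.1, ht.2.trans one_pos⟩
  have hlt : t < t ^ (n + 1) := by
    have h1 : |t| ^ (n + 1) < |t| :=
      pow_lt_self_of_lt_one₀ (abs_pos.2 ht.2.ne) (abs_lt_one_of_mem hQ hT) (by omega)
    have h2 := neg_abs_le (t ^ (n + 1))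
    rw [abs_pow] at h2
    rw [abs_of_neg ht.2] at h1 h2
    linarith
  have := logOdds_strictMonoOn hQ hT (pow_succ_mem hQ hT n) hlt
  unfold growthSlope
  linarith

/-- As `t → 1`, both `L(t)` and `L(t ^ (n + 1))` grow like `-ln (1 - t)`, so a factor `e ≥ 2` wins.
Bernoulli's inequality makes this explicit by comparing `L(t)` with `2 L(t ^ (n + 1))`. -/
lemma exists_growthSlope_neg (hQ : 1 ≤ Q) (he : 2 ≤ e) (ha : a ∈ Ioo (0 : ℝ) 1) :
    ∃ t ∈ Ioo a 1, growthSlope Q n e t < 0 := by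
  have hcont : Continuous fun t : ℝ =>
      (1 + Q * t ^ (n + 1)) ^ 2 - (1 + Q * t) * ((n + 1) ^ 2 * (1 - t)) := by fun_prop
  have hev : ∀ᶠ t in 𝓝 (1:ℝ),
      0 < (1 + Q * t ^ (n + 1)) ^ 2 - (1 + Q * t) * ((n + 1) ^ 2 * (1 - t)) := by
    refine hcont.continuousAt.eventually_const_lt ?_
    simp only [one_pow, sub_self, mul_zero, sub_zero, mul_one]
    positivity
  obtain ⟨t, hpos, hta⟩ := ((hev.filter_mono (nhdsWithin_le_nhds (s := Iio 1))).and
    (Ioo_mem_nhdsLT ha.2)).exists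
  refine ⟨t, hta, ?_⟩
  have ht0 : 0 < t := ha.1.trans hta.1
  have hT := mem_of_mem_Ico_zero_one hQ ⟨ht0.le, hta.2⟩
  have h1 := one_add_mul_pos_of_mem hQ hT
  have h2 : 0 < 1 - t := sub_pos.2 hta.2
  have h3 := one_add_pow_mul_pos hQ hT n
  have h4 : 0 < 1 - t ^ (n + 1) := sub_pos.2 (pow_succ_mem hQ hT n).2
  have hbern : 1 - t ^ (n + 1) ≤ (n + 1) * (1 - t) := by
    have := one_add_mul_le_pow (by linarith : (-2 : ℝ) ≤ t - 1) (n + 1)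
    rw [add_sub_cancel] at this
    push_cast at this
    linarith
  have hlt : (1 + Q * t) * (1 - t ^ (n + 1)) ^ 2 < (1 - t) * (1 + Q * t ^ (n + 1)) ^ 2 := by
    calc (1 + Q * t) * (1 - t ^ (n + 1)) ^ 2 ≤ (1 + Q * t) * ((n + 1) * (1 - t)) ^ 2 := by gcongr
      _ = (1 - t) * ((1 + Q * t) * ((n + 1) ^ 2 * (1 - t))) := by ring
      _ < (1 - t) * (1 + Q * t ^ (n + 1)) ^ 2 := mul_lt_mul_of_pos_left (by linarith) h2
  have hlog := Real.log_lt_log (by positivity) hlt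
  rw [Real.log_mul h1.ne' (by positivity), Real.log_mul h2.ne' (by positivity), Real.log_pow,
    Real.log_pow] at hlog
  have hL := logOdds_pos hQ (t := t ^ (n + 1)) ⟨by positivity, by linarith⟩
  have := mul_le_mul_of_nonneg_right he hL.le
  unfold growthSlope
  unfold logOdds at *
  push_cast at hlog
  linarith

end SlopeSigns

/-! ### Assembling the shape for `c ≥ 3`. -/

section Shape

variable {n : ℕ} {a b e : ℝ} {f : ℝ → ℝ}

/-- The shape of the growth rate on `(0, 1 - 1 / q)` for `c ≥ 3`. -/
lemma exists_shape_of_two_le {Q p : ℝ} (hQ : 1 ≤ Q) (hn : 1 ≤ n) (he : 2 ≤ e)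
    (himg : critPoint Q n '' Ioo (-Q⁻¹) 1 = Ioo 0 b) (hp : critPoint Q n 0 = p)
    (hc : ContinuousOn f (Icc 0 b))
    (hf : ∀ x ∈ Ioo 0 b, HasDerivAt f (growthSlope Q n e (critParam Q n x)) x)
    (hf0 : f 0 = 0) (hfp : 0 ≤ f p) :
    ∃ a ∈ Ioo (0 : ℝ) 1, (∀ t ∈ Ico 0 a, 0 < slopeSign Q n e t) ∧ critPoint Q n a ∈ Ioo 0 p ∧
      ConvexOn ℝ (Ioo 0 (critPoint Q n a)) f ∧
      ∃ x₃ ∈ Ioo 0 (critPoint Q n a), StrictAntiOn f (Ioo 0 x₃) ∧ StrictMonoOn f (Ioo x₃ p) ∧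
        ∃ x₀ ∈ Ioc x₃ p, f x₀ = 0 ∧ (∀ x ∈ Ioc 0 p, f x = 0 → x = x₀) ∧
          (∀ x ∈ Ioo 0 x₀, f x < 0) ∧ ∀ x ∈ Ioo x₀ p, 0 < f x := by
  obtain ⟨a, ha, hNpos, hNneg⟩ := exists_slopeSign_change (e := e) hQ hn (Or.inl (by linarith))
  have hT : ∀ {t}, 0 ≤ t → t < 1 → t ∈ Ioo (-Q⁻¹) 1 := fun h0 h1 =>
    mem_of_mem_Ico_zero_one hQ ⟨h0, h1⟩
  have hXanti := critPoint_strictAntiOn hQ hn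
  have hXmem : ∀ {t}, t ∈ Ioo (-Q⁻¹) 1 → critPoint Q n t ∈ Ioo 0 b := fun h =>
    himg ▸ mem_image_of_mem _ h
  have hTa := hT ha.1.le ha.2
  have hT0 := zero_mem_Ioo_neg_inv hQ
  have hτ := (critParam_strictAntiOn hQ hn himg).antitoneOn
  have hpb : p < b := hp ▸ (hXmem hT0).2
  have hKmono : StrictMonoOn (growthSlope Q n e) (Icc 0 a) := by
    refine growthSlope_strictMonoOn hQ (convex_Icc 0 a)
      (fun t ht => hT ht.1 (ht.2.trans_lt ha.2)) ?_
    rw [interior_Icc]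
    exact fun t ht => hNpos t ⟨ht.1.le, ht.2⟩
  have hKanti : StrictAntiOn (growthSlope Q n e) (Ico a 1) := by
    refine growthSlope_strictAntiOn hQ (convex_Ico a 1)
      (fun t ht => hT (ha.1.le.trans ht.1) ht.2) ?_
    rw [interior_Ico]
    exact hNneg
  have hKa : 0 < growthSlope Q n e a := by
    have := hKmono ⟨le_rfl, ha.1.le⟩ ⟨ha.1.le, le_rfl⟩ ha.1
    rwa [growthSlope_zero] at this
  obtain ⟨t₁, ht₁, hKt₁⟩ := exists_growthSlope_neg (n := n) hQ he ha
  -- The slope rises from `0` on `[0, a]`, then falls and becomes negative, so it has one zero `s`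
  -- in `(0, 1)`. Then `critPoint Q n s` serves as `x₃`, and `critPoint Q n a` as `x₂`.
  obtain ⟨s, hs, hKs⟩ : (0:ℝ) ∈ growthSlope Q n e '' Icc a t₁ :=
    intermediate_value_Icc' ht₁.1.le ((continuousOn_growthSlope hQ).mono fun t ht =>
      hT (ha.1.le.trans ht.1) (ht.2.trans_lt ht₁.2)) ⟨hKt₁.le, hKa.le⟩
  have has : a < s := hs.1.lt_of_ne (by rintro rfl; exact hKa.ne' hKs)
  have hs1 : s < 1 := hs.2.trans_lt ht₁.2
  have hTs := hT (ha.1.le.trans hs.1) hs1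
  have hXap : critPoint Q n a < p := hp ▸ hXanti hT0 hTa ha.1
  have hXsa : critPoint Q n s < critPoint Q n a := hXanti hTa hTs has
  have hKpos : ∀ t ∈ Ioo 0 s, 0 < growthSlope Q n e t := by
    intro t ht
    rcases le_or_gt t a with h | h
    · have := hKmono ⟨le_rfl, ha.1.le⟩ ⟨ht.1.le, h⟩ ht.1
      rwa [growthSlope_zero] at this
    · exact hKs ▸ hKanti ⟨h.le, ht.2.trans hs1⟩ ⟨has.le, hs1⟩ ht.2
  have hanti : StrictAntiOn f (Icc 0 (critPoint Q n s)) := by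
    refine strictAntiOn_Icc_of_hasDerivAt hc le_rfl (hXmem hTs).2.le fun x hx => ?_
    have hxb : x ∈ Ioo 0 b := ⟨hx.1, hx.2.trans (hXmem hTs).2⟩
    refine ⟨_, ?_, hf x hxb⟩
    have hlt := (lt_critParam_iff hQ hn himg hxb hTs).2 hx.2
    exact hKs ▸ hKanti ⟨has.le, hs1⟩ ⟨(has.trans hlt).le, (critParam_mem himg hxb).2⟩ hlt
  have hmono : StrictMonoOn f (Icc (critPoint Q n s) p) := by
    refine strictMonoOn_Icc_of_hasDerivAt hc (hXmem hTs).1.le hpb.le fun x hx => ?_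
    have hxb : x ∈ Ioo 0 b := ⟨(hXmem hTs).1.trans hx.1, hx.2.trans hpb⟩
    exact ⟨_, hKpos _ ⟨(lt_critParam_iff hQ hn himg hxb hT0).2 (hp ▸ hx.2),
      (critParam_lt_iff hQ hn himg hxb hTs).2 hx.1⟩, hf x hxb⟩
  refine ⟨a, ha, hNpos, ⟨(hXmem hTa).1, hXap⟩, ?_, critPoint Q n s, ⟨(hXmem hTs).1, hXsa⟩,
    hanti.mono Ioo_subset_Icc_self, hmono.mono Ioo_subset_Icc_self,
    exists_unique_zero_of_valley (hXmem hTs).1 (hXsa.trans hXap) hf0 hfp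
      (hc.mono (Icc_subset_Icc_right hpb.le)) hanti hmono⟩
  have hsub : Ioo 0 (critPoint Q n a) ⊆ Ioo 0 b := Ioo_subset_Ioo_right (hXmem hTa).2.le
  exact convexOn_of_hasDerivAt_comp (S := Ico a 1)
    (fun x hx => hf x (hsub hx)) (hτ.mono hsub)
    (fun x hx => ⟨((lt_critParam_iff hQ hn himg (hsub hx) hTa).2 hx.2).le,
      (critParam_mem himg (hsub hx)).2⟩) hKanti.antitoneOn

/-- The excluded case `Q = 1`, `n` even is genuine: there `slopeSign` is an even function of `t`, so
a sign change at `a` is mirrored at `-a`, in line with `ω(1 - x) = ω(x)`. -/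
lemma slopeSign_pos_of_lt {Q t : ℝ} (hQ : 1 ≤ Q) (hn : 1 ≤ n) (he : 0 ≤ e) (hen : e ≤ n + 1)
    (hcase : 2 ≤ Q ∨ Odd n) (hpos : ∀ t ∈ Ico 0 a, 0 < slopeSign Q n e t)
    (ht : t ∈ Ioo (-Q⁻¹) 1) (hta : t < a) : 0 < slopeSign Q n e t := by
  rcases le_or_gt 0 t with h | h
  · exact hpos t ⟨h, hta⟩
  · rcases hcase with hQ2 | hodd
    · exact slopeSign_pos_of_two_le hQ2 hn he hen ht h
    · exact slopeSign_pos_of_nonpos hQ ht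
        (mul_nonpos_of_nonneg_of_nonpos he (hodd.pow_neg h).le)

end Shape

/-! ### The theorem. -/

theorem mainTheorem2 (q c d : ℕ) (hq : 2 ≤ q) (hc : 1 ≤ c) (hd : max c 3 ≤ d) :
    -- on `[0, x₁]` the growth rate is finite, i.e. equal to its real version
    (∀ x ∈ Set.Icc 0 (xOne q d), omegaLDPC q c d x = (omegaReal q c d x : EReal)) ∧
    ContinuousOn (omegaReal q c d) (Set.Icc 0 (xOne q d)) ∧
    (∀ x ∈ Set.Ioo 0 (xOne q d), DifferentiableAt ℝ (omegaReal q c d) x ∧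
      DifferentiableAt ℝ (deriv (omegaReal q c d)) x) ∧
    -- the case `c = 1`
    (c = 1 →
      ConcaveOn ℝ (Set.Ioo 0 (xOne q d)) (omegaReal q c d) ∧
      StrictMonoOn (omegaReal q c d) (Set.Ioo 0 (1 - 1 / (q : ℝ))) ∧
      StrictAntiOn (omegaReal q c d) (Set.Ioo (1 - 1 / (q : ℝ)) (xOne q d))) ∧
    -- the case `c = 2`
    (c = 2 →
      StrictMonoOn (omegaReal q c d) (Set.Ioo 0 (1 - 1 / (q : ℝ))) ∧
      StrictAntiOn (omegaReal q c d) (Set.Ioo (1 - 1 / (q : ℝ)) (xOne q d)) ∧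
      (q = 2 → ConcaveOn ℝ (Set.Ioo 0 (xOne q d)) (omegaReal q c d)) ∧
      (q ≠ 2 → ∃ x₂ ∈ Set.Ioo 0 (1 - 1 / (q : ℝ)),
        ConvexOn ℝ (Set.Ioo 0 x₂) (omegaReal q c d) ∧
        ConcaveOn ℝ (Set.Ioo x₂ 1) (omegaReal q c d))) ∧
    -- the case `c ≥ 3`, `q = 2`, `d` even
    (3 ≤ c → q = 2 → Even d →
      (∀ x ∈ Set.Icc (0 : ℝ) 1, omegaReal q c d (1 - x) = omegaReal q c d x) ∧
      ∃ x₂ ∈ Set.Ioo (0 : ℝ) (1 / 2),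
        ConvexOn ℝ (Set.Ioo 0 x₂) (omegaReal q c d) ∧
        ConcaveOn ℝ (Set.Ioo x₂ (1 / 2)) (omegaReal q c d) ∧
        ∃ x₃ ∈ Set.Ioo 0 x₂,
          StrictAntiOn (omegaReal q c d) (Set.Ioo 0 x₃) ∧
          StrictMonoOn (omegaReal q c d) (Set.Ioo x₃ (1 / 2)) ∧
          ∃ x₀ ∈ Set.Ioc x₃ (1 / 2),
            omegaReal q c d x₀ = 0 ∧
            (∀ x ∈ Set.Ioc (0 : ℝ) (1 / 2), omegaReal q c d x = 0 → x = x₀) ∧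
            (∀ x ∈ Set.Ioo 0 x₀, omegaReal q c d x < 0) ∧
            (∀ x ∈ Set.Ioo x₀ (1 / 2), 0 < omegaReal q c d x)) ∧
    -- the remaining cases: `c ≥ 3`, and `q ≠ 2` or `d` odd
    (3 ≤ c → (q ≠ 2 ∨ Odd d) →
      ∃ x₂ ∈ Set.Ioo 0 (1 - 1 / (q : ℝ)),
        ConvexOn ℝ (Set.Ioo 0 x₂) (omegaReal q c d) ∧
        ConcaveOn ℝ (Set.Ioo x₂ (xOne q d)) (omegaReal q c d) ∧
        ∃ x₃ ∈ Set.Ioo 0 x₂,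
          StrictAntiOn (omegaReal q c d) (Set.Ioo 0 x₃) ∧
          StrictMonoOn (omegaReal q c d) (Set.Ioo x₃ (1 - 1 / (q : ℝ))) ∧
          StrictAntiOn (omegaReal q c d) (Set.Ioo (1 - 1 / (q : ℝ)) (xOne q d)) ∧
          ∃ x₀ ∈ Set.Ioc x₃ (1 - 1 / (q : ℝ)),
            omegaReal q c d x₀ = 0 ∧
            (∀ x ∈ Set.Ioc 0 (1 - 1 / (q : ℝ)), omegaReal q c d x = 0 → x = x₀) ∧
            (∀ x ∈ Set.Ioo 0 x₀, omegaReal q c d x < 0) ∧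
            (∀ x ∈ Set.Ioo x₀ (1 - 1 / (q : ℝ)), 0 < omegaReal q c d x)) := by
  obtain ⟨n, rfl⟩ : ∃ n, d = n + 2 := ⟨d - 2, by omega⟩
  have hn : 1 ≤ n := by omega
  have hcn : (c : ℝ) ≤ n + 2 := by exact_mod_cast (le_max_left c 3).trans hd
  have hQ := one_le_natCast_sub_one hq
  have hqQ : q = 2 ↔ (q : ℝ) - 1 = 1 :=
    ⟨fun h => by rw [h]; norm_num, fun h => by
      have : (q : ℝ) = 2 := by linarith
      exact_mod_cast this⟩
  have hq3 : q ≠ 2 → 2 ≤ (q : ℝ) - 1 := fun h => by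
    have : (3 : ℝ) ≤ q := by exact_mod_cast (show 3 ≤ q by omega)
    linarith
  have hQ2 : (q : ℝ) - 1 = 1 ∨ 2 ≤ (q : ℝ) - 1 := by
    by_cases h : q = 2
    · exact Or.inl (hqQ.1 h)
    · exact Or.inr (hq3 h)
  have hoddn : Odd (n + 2) ↔ Odd n := by
    rw [← Nat.not_even_iff_odd, ← Nat.not_even_iff_odd, Nat.even_add]; simp
  have hb : xOne q (n + 2) =
      if (q : ℝ) - 1 = 1 ∧ Odd n then 1 - 1 / ((n : ℝ) + 2) else 1 := by
    unfold xOne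
    rw [if_congr (and_congr hqQ hoddn) rfl rfl]
    push_cast
    congr
  have hb1 : q ≠ 2 → xOne q (n + 2) = 1 := fun h => by unfold xOne; rw [if_neg (by tauto)]
  have hb01 : 0 < xOne q (n + 2) ∧ xOne q (n + 2) ≤ 1 := by
    rw [hb]
    split_ifs
    · have h1 : 1 / ((n : ℝ) + 2) < 1 := by
        rw [div_lt_one (by positivity)]
        linarith [Nat.cast_nonneg (α := ℝ) n]
      have h2 : 0 < 1 / ((n : ℝ) + 2) := by positivity
      exact ⟨by linarith, by linarith⟩
    · exact ⟨one_pos, le_rfl⟩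
  set b := xOne q (n + 2) with hbdef
  have hfin : ∀ x ∈ Icc 0 b, omegaLDPC q c (n + 2) x = (growthRate q n c x : EReal) := fun x hx =>
    omegaLDPC_eq hq ⟨hx.1, hx.2.trans hb01.2⟩ c (isGLB_potential hQ hb hQ2 hb01.1 hx)
  have hreal : EqOn (omegaReal q c (n + 2)) (growthRate q n c) (Icc 0 b) := fun x hx => by
    rw [omegaReal, hfin x hx, EReal.toReal_coe]
  have himg := critPoint_image hQ hb hQ2 hn
  have hcont : ContinuousOn (omegaReal q c (n + 2)) (Icc 0 b) :=
    (continuousOn_growthRate hq hn hb hQ2 hb01.1).congr hreal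
  have hder : ∀ x ∈ Ioo 0 b, HasDerivAt (omegaReal q c (n + 2))
      (growthSlope ((q : ℝ) - 1) n (c - 1) (critParam ((q : ℝ) - 1) n x)) x := fun x hx =>
    (hasDerivAt_growthRate hq hn himg hx).congr_of_eventuallyEq (by
      filter_upwards [isOpen_Ioo.mem_nhds hx] with y hy using hreal (Ioo_subset_Icc_self hy))
  have hp : critPoint ((q : ℝ) - 1) n 0 = 1 - 1 / (q : ℝ) := by
    have : (q : ℝ) ≠ 0 := by linarith
    rw [critPoint_zero]; field_simp; ring
  have hT0 := zero_mem_Ioo_neg_inv hQ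
  have hpmem : 1 - 1 / (q : ℝ) ∈ Ioo 0 b := hp ▸ himg ▸ mem_image_of_mem _ hT0
  have hτ := (critParam_strictAntiOn hQ hn himg).antitoneOn
  have hmaps : MapsTo (critParam ((q : ℝ) - 1) n) (Ioo 0 b) (Ioo (-((q : ℝ) - 1)⁻¹) 1) :=
    fun x hx => critParam_mem himg hx
  have hincr : (∀ t ∈ Ioo (0 : ℝ) 1, 0 < growthSlope ((q : ℝ) - 1) n (c - 1) t) →
      StrictMonoOn (omegaReal q c (n + 2)) (Ioo 0 (1 - 1 / (q : ℝ))) := fun h =>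
    (strictMonoOn_Icc_of_hasDerivAt hcont le_rfl hpmem.2.le fun x hx => by
      have hxb : x ∈ Ioo 0 b := ⟨hx.1, hx.2.trans hpmem.2⟩
      exact ⟨_, h _ ⟨(lt_critParam_iff hQ hn himg hxb hT0).2 (hp ▸ hx.2), (hmaps hxb).2⟩,
        hder x hxb⟩).mono Ioo_subset_Icc_self
  have hdecr : (∀ t ∈ Ioo (-((q : ℝ) - 1)⁻¹) 0, growthSlope ((q : ℝ) - 1) n (c - 1) t < 0) →
      StrictAntiOn (omegaReal q c (n + 2)) (Ioo (1 - 1 / (q : ℝ)) b) := fun h =>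
    (strictAntiOn_Icc_of_hasDerivAt hcont hpmem.1.le le_rfl fun x hx => by
      have hxb : x ∈ Ioo 0 b := ⟨hpmem.1.trans hx.1, hx.2⟩
      exact ⟨_, h _ ⟨(hmaps hxb).1, (critParam_lt_iff hQ hn himg hxb hT0).2 (hp ▸ hx.1)⟩,
        hder x hxb⟩).mono Ioo_subset_Icc_self
  -- Positivity of `slopeSign` left of `a`, negative parameters included, gives concavity all the
  -- way to `x₁`.
  have hconcave : ∀ a ∈ Ioo (0 : ℝ) 1, (2 ≤ (q : ℝ) - 1 ∨ Odd n) → 0 ≤ (c : ℝ) - 1 →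
      (∀ t ∈ Ico 0 a, 0 < slopeSign ((q : ℝ) - 1) n (c - 1) t) →
      StrictMonoOn (growthSlope ((q : ℝ) - 1) n (c - 1)) (Ioc (-((q : ℝ) - 1)⁻¹) a) ∧
      ConcaveOn ℝ (Ioo (critPoint ((q : ℝ) - 1) n a) b) (omegaReal q c (n + 2)) := by
    intro a ha hcase he hpos
    have hTa := mem_of_mem_Ico_zero_one hQ ⟨ha.1.le, ha.2⟩
    have hK : StrictMonoOn (growthSlope ((q : ℝ) - 1) n (c - 1)) (Ioc (-((q : ℝ) - 1)⁻¹) a) := by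
      refine growthSlope_strictMonoOn hQ (convex_Ioc _ _)
        (fun t ht => ⟨ht.1, ht.2.trans_lt ha.2⟩) ?_
      rw [interior_Ioc]
      exact fun t ht => slopeSign_pos_of_lt hQ hn he (by linarith) hcase hpos
        ⟨ht.1, ht.2.trans ha.2⟩ ht.2
    have hsub : Ioo (critPoint ((q : ℝ) - 1) n a) b ⊆ Ioo 0 b :=
      Ioo_subset_Ioo_left (critPoint_mem_Ioo hQ hTa).1.le
    exact ⟨hK, concaveOn_of_hasDerivAt_comp (S := Ioc (-((q : ℝ) - 1)⁻¹) a)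
      (fun x hx => hder x (hsub hx)) (hτ.mono hsub)
      (fun x hx => ⟨(hmaps (hsub hx)).1,
        ((critParam_lt_iff hQ hn himg (hsub hx) hTa).2 hx.1).le⟩) hK.monotoneOn⟩
  have hω0 : omegaReal q c (n + 2) 0 = 0 := by
    rw [hreal ⟨le_rfl, hb01.1.le⟩, growthRate_zero hq]
  have hωp : 0 ≤ omegaReal q c (n + 2) (1 - 1 / (q : ℝ)) := by
    rw [hreal (Ioo_subset_Icc_self hpmem), growthRate_one_sub_inv hq hn]
    refine mul_nonneg (sub_nonneg.2 ((div_le_one (by positivity)).2 hcn))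
      (Real.log_nonneg (by linarith))
  refine ⟨fun x hx => by rw [hreal hx, hfin x hx], hcont, fun x hx =>
    ⟨(hder x hx).differentiableAt, ?_⟩, ?_, ?_, ?_, ?_⟩
  · have hev : deriv (omegaReal q c (n + 2)) =ᶠ[𝓝 x] fun y =>
        growthSlope ((q : ℝ) - 1) n (c - 1) (critParam ((q : ℝ) - 1) n y) := by
      filter_upwards [isOpen_Ioo.mem_nhds hx] with y hy using (hder y hy).deriv
    obtain ⟨v, -, -, hv⟩ := hasDerivAt_critParam hQ hn himg hx
    exact ((HasDerivAt.comp (h₂ := growthSlope ((q : ℝ) - 1) n (c - 1)) x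
      (hasDerivAt_growthSlope hQ (hmaps hx)) hv).congr_of_eventuallyEq hev).differentiableAt
  · rintro rfl
    have hK : growthSlope ((q : ℝ) - 1) n ((1 : ℕ) - 1) = logOdds ((q : ℝ) - 1) := by
      ext t; simp [growthSlope]
    rw [hK] at hincr hdecr
    simp only [hK] at hder
    exact ⟨concaveOn_of_hasDerivAt_comp hder hτ hmaps (logOdds_strictMonoOn hQ).monotoneOn,
      hincr fun t ht => logOdds_pos hQ ht, hdecr fun t ht => logOdds_neg hQ ht⟩
  · rintro rfl
    have h21 : ((2 : ℕ) : ℝ) - 1 = 1 := by norm_num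
    rw [h21] at hincr hdecr hconcave
    simp only [h21] at hder
    refine ⟨hincr fun t ht => growthSlope_one_pos hQ hn ht,
      hdecr fun t ht => growthSlope_one_neg hQ hn ht, fun h2 => ?_, fun h2 => ?_⟩
    · refine concaveOn_of_hasDerivAt_comp hder hτ hmaps
        (growthSlope_monotoneOn hQ (convex_Ioo _ _) Subset.rfl fun t ht => ?_)
      have := slopeSign_binary_nonneg hn (abs_lt_one_of_mem hQ (interior_subset ht))
      rwa [hqQ.1 h2]
    · have hQ3 := hq3 h2
      obtain ⟨a, ha, hpos, hneg⟩ := exists_slopeSign_change (n := n) (e := 1) hQ hn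
        (Or.inr ⟨rfl, by linarith⟩)
      have hTa := mem_of_mem_Ico_zero_one hQ ⟨ha.1.le, ha.2⟩
      have hXa : critPoint ((q : ℝ) - 1) n a ∈ Ioo 0 b := himg ▸ mem_image_of_mem _ hTa
      have hsub : Ioo 0 (critPoint ((q : ℝ) - 1) n a) ⊆ Ioo 0 b := Ioo_subset_Ioo_right hXa.2.le
      refine ⟨critPoint ((q : ℝ) - 1) n a,
        ⟨hXa.1, hp ▸ critPoint_strictAntiOn hQ hn hT0 hTa ha.1⟩, ?_, ?_⟩
      · have hK : StrictAntiOn (growthSlope ((q : ℝ) - 1) n 1) (Ioo a 1) := by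
          refine growthSlope_strictAntiOn hQ (convex_Ioo a 1)
            (fun t ht => mem_of_mem_Ico_zero_one hQ ⟨(ha.1.trans ht.1).le, ht.2⟩) ?_
          rw [interior_Ioo]
          exact hneg
        exact convexOn_of_hasDerivAt_comp (S := Ioo a 1)
          (fun x hx => hder x (hsub hx)) (hτ.mono hsub)
          (fun x hx => ⟨(lt_critParam_iff hQ hn himg (hsub hx) hTa).2 hx.2,
            (hmaps (hsub hx)).2⟩) hK.antitoneOn
      · have := (hconcave a ha (Or.inl hQ3) zero_le_one hpos).2
        rwa [hb1 h2] at this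
  · intro hc3 h2 heven
    have he : 2 ≤ (c : ℝ) - 1 := by
      have : (3 : ℝ) ≤ c := by exact_mod_cast hc3
      linarith
    refine ⟨fun x _ => by rw [h2]; exact omegaReal_one_sub c heven, ?_⟩
    obtain ⟨a, ha, hpos, hXa, hconv, x₃, hx₃, h3⟩ :=
      exists_shape_of_two_le hQ hn he himg hp hcont hder hω0 hωp
    have hhalf : 1 - 1 / (q : ℝ) = 1 / 2 := by rw [h2]; norm_num
    have hTa := mem_of_mem_Ico_zero_one hQ ⟨ha.1.le, ha.2⟩
    rw [hhalf] at hXa h3 hp hpmem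
    refine ⟨critPoint ((q : ℝ) - 1) n a, hXa, hconv, ?_, x₃, hx₃, h3⟩
    -- Only parameters in `(0, a)` are used, so concavity stops at `1/2`; the other half follows
    -- from the symmetry.
    have hK : StrictMonoOn (growthSlope ((q : ℝ) - 1) n (c - 1)) (Ioo 0 a) := by
      refine growthSlope_strictMonoOn hQ (convex_Ioo 0 a)
        (fun t ht => mem_of_mem_Ico_zero_one hQ ⟨ht.1.le, ht.2.trans ha.2⟩) ?_
      rw [interior_Ioo]
      exact fun t ht => hpos t ⟨ht.1.le, ht.2⟩
    have hsub : Ioo (critPoint ((q : ℝ) - 1) n a) (1 / 2) ⊆ Ioo 0 b :=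
      Ioo_subset_Ioo hXa.1.le hpmem.2.le
    exact concaveOn_of_hasDerivAt_comp (S := Ioo 0 a)
      (fun x hx => hder x (hsub hx)) (hτ.mono hsub)
      (fun x hx => ⟨(lt_critParam_iff hQ hn himg (hsub hx) hT0).2 (hp ▸ hx.2),
        (critParam_lt_iff hQ hn himg (hsub hx) hTa).2 hx.1⟩) hK.monotoneOn
  · intro hc3 hcase
    have he : 2 ≤ (c : ℝ) - 1 := by
      have : (3 : ℝ) ≤ c := by exact_mod_cast hc3
      linarith
    obtain ⟨a, ha, hpos, hXa, hconv, x₃, hx₃, hanti, hmono, h0⟩ :=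
      exists_shape_of_two_le hQ hn he himg hp hcont hder hω0 hωp
    obtain ⟨hK, hconc⟩ := hconcave a ha (hcase.imp hq3 hoddn.1) (by linarith) hpos
    refine ⟨critPoint ((q : ℝ) - 1) n a, hXa, hconv, hconc, x₃, hx₃, hanti, hmono, ?_, h0⟩
    refine hdecr fun t ht => ?_
    -- The slope vanishes at `t = 0` and increases up to `a`, hence is negative for `t < 0`.
    have := hK ⟨ht.1, ht.2.le.trans ha.1.le⟩ ⟨hT0.1, ha.1.le⟩ ht.2
    rwa [growthSlope_zero] at this
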